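/- Let $n,m,p$ be positive integers with $p<n(m-n+1)$, and let $N_0>0$. For a Hermitian positive definite matrix $\mathbf R\in\mathbb C^{n\times n}$ write $\mathbf X\sim\mathcal{CN}_{n,m}(\mathbf 0,\mathbf R)$ if $\mathbf X$ is a random $n\times m$ complex matrix whose columns are independent, each with the centred circularly symmetric complex Gaussian density $\mathbf x\mapsto \pi^{-n}\det(\mathbf R)^{-1}e^{-\mathbf x^\dagger \mathbf R^{-1}\mathbf x}$ on $\mathbb C^n$. Put $$W=\frac{\frac1n\operatorname{Tr}(\mathbf X\mathbf X^\dagger)}{\det(\mathbf X\mathbf X^\dagger)^{1/n}}.$$ (i) Let $W_0$ denote $W$ when $\mathbf X\sim\mathcal{CN}_{n,m}(\mathbf 0,N_0\mathbf I_n)$. Its $p$th moment is finite and $$\mathrm E[W_0^p]=\frac{\Gamma(mn)}{n^p\,\Gamma(mn-p)}\prod_{j=0}^{n-1}\frac{\Gamma\left(m-n+1-\frac pn+j\right)}{\Gamma(m-n+1+j)} .$$ (ii) Let $\mathbf H\in\mathbb C^{n\times k}$ be a deterministic matrix such that $\mathbf H\mathbf H^\dagger$ is positive definite, let $y_1\le\dots\le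 y_n$ be the eigenvalues of $\mathbf H\mathbf H^\dagger+N_0\mathbf I_n$, counted with multiplicity, and let $W_1$ denote $W$ when $\mathbf X\sim\mathcal{CN}_{n,m}(\mathbf 0,\mathbf H\mathbf H^\dagger+N_0\mathbf I_n)$. Then $y_i>N_0$ for all $i$, the $p$th moment of $W_1$ is finite, and $$\mathrm E[W_1^p]=\frac{p!\,\prod_{i=1}^n y_i^{-p/n}}{n^p}\prod_{j=0}^{n-1}\frac{\Gamma\left(m-n+1-\frac pn+j\right)}{\Gamma(m-n+1+j)}\sum_{k_1+\dots+k_n=p}\ \prod_{i=1}^n\frac{\Gamma\left(m-\frac pn+k_i\right)y_i^{k_i}}{\Gamma(k_i+1)\,\Gamma\left(m-\frac pn\right)},$$ where the sum runs over all $n$-tuples $(k_1,\dots,k_n)$ of nonnegative integers with sum $p$. -/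

import Mathlib

open MeasureTheory ProbabilityTheory Matrix
open scoped ComplexOrder

noncomputable section

/-- The centred circularly symmetric complex Gaussian law on `ℂⁿ` with (Hermitian positive
definite) covariance matrix `R`: the measure with density
`x ↦ π⁻ⁿ det(R)⁻¹ exp(-x† R⁻¹ x)` with respect to Lebesgue measure on `ℂⁿ`. -/
def complexGaussian {n : ℕ} (R : Matrix (Fin n) (Fin n) ℂ) : Measure (Fin n → ℂ) :=
  (volume : Measure (Fin n → ℂ)).withDensity fun x =>
    ENNReal.ofReal (Real.exp (-(star x ⬝ᵥ (R⁻¹ *ᵥ x)).re) / (Real.pi ^ n * R.det.re))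

/-- The random `n × m` matrix `X` has independent columns, each of which is a centred complex
Gaussian vector with covariance matrix `R`. -/
structure IsComplexGaussianMatrix {Ω : Type*} [MeasurableSpace Ω] {n m : ℕ}
    (X : Ω → Matrix (Fin n) (Fin m) ℂ) (R : Matrix (Fin n) (Fin n) ℂ) (P : Measure Ω) : Prop where
  hasLaw_col : ∀ l : Fin m, HasLaw (fun ω => (X ω).col l) (complexGaussian R) P
  iIndepFun_col : iIndepFun (fun (l : Fin m) ω => (X ω).col l) P

/-- The statistic `(Tr(X X†) / n) / det(X X†)^(1/n)`. -/
def glrtStatistic {n m : ℕ} (X : Matrix (Fin n) (Fin m) ℂ) : ℝ :=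
  ((X * Xᴴ).trace.re / n) / (X * Xᴴ).det.re ^ (1 / (n : ℝ))

/-- The covariance matrix `H H† + N₀ I` of the observations. -/
def signalCovariance {n k : ℕ} (H : Matrix (Fin n) (Fin k) ℂ) (N₀ : ℝ) :
    Matrix (Fin n) (Fin n) ℂ :=
  H * Hᴴ + (N₀ : ℂ) • (1 : Matrix (Fin n) (Fin n) ℂ)

end

/-!
The statistic depends on the data only through a weighted sum of squared row norms and a Gram
determinant. Indeed, if `R = A A†` with `A† A = diag y`, then `X` has the law of `A Z` for a
standard complex Gaussian matrix `Z` (`IsComplexGaussianMatrix.lintegral_eq`), and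
`Tr(X X†) = ∑ yᵢ ‖zᵢ‖²`, `det(X X†) = (∏ yᵢ) det(Z Z†)`, where the `zᵢ` are the rows of `Z`
(`glrtStatistic_mul_pow`). For the signal covariance, `A` is a unitary matrix times `diag √y`.

It remains to integrate `(∑ yᵢ ‖zᵢ‖²)^p det(Z Z†)^(-s)` with `s = p / n`. Two facts suffice.

* The weight `det(Z Z†)^(-s)` is homogeneous of degree `-2s` in each row. By scaling, a homogeneous
  weight of degree `2β` on a Gaussian space of real dimension `D` gives the squared norm the moments
  of a gamma variable of shape `D / 2 + β` (`lintegral_pow_mul_exp_neg_of_homogeneous`). Applied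
  row by row and combined with the multinomial theorem, this gives the sum over compositions of `p`;
  for equal eigenvalues, applied once to the whole matrix, it gives `Γ(mn) / Γ(mn - p)`.
* `E det(Z Z†)^(-s)` is a product of gamma quotients (`lintegral_gramDet_rpow_neg`), because adding
  a row to `n` rows of length `m` multiplies the Gram determinant by the squared distance of the new
  row from their span, a gamma variable of shape `m - n` (`lintegral_gramDet_cons_rpow_neg`).

Everything is computed with lower integrals of nonnegative functions, so finiteness of the moments
comes with their values.
-/

/-! ### Product measures with densities, and densities transported by linear isomorphisms -/

/-- Tonelli's theorem for a product of functions of one coordinate each. -/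
theorem lintegral_pi_prod_eq_prod {ι : Type*} [Fintype ι] {α : ι → Type*}
    [∀ i, MeasurableSpace (α i)] (μ : ∀ i, Measure (α i)) [∀ i, SigmaFinite (μ i)]
    {f : ∀ i, α i → ENNReal} (hf : ∀ i, Measurable (f i)) :
    ∫⁻ x, ∏ i, f i (x i) ∂Measure.pi μ = ∏ i, ∫⁻ x, f i x ∂μ i := by
  classical
  have key : ∀ s : Finset ι, ∀ x : ∀ i, α i,
      lmarginal μ s (fun x => ∏ i ∈ s, f i (x i)) x = ∏ i ∈ s, ∫⁻ x, f i x ∂μ i := by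
    intro s
    induction s using Finset.induction_on with
    | empty => simp
    | insert i s hi ih =>
      intro x
      have hm : ∀ t : Finset ι, Measurable fun x : ∀ i, α i => ∏ i ∈ t, f i (x i) := fun t =>
        Finset.measurable_prod _ fun j _ => (hf j).comp (measurable_pi_apply j)
      rw [lmarginal_insert' _ (hm _) hi, Finset.prod_insert hi, ← ih x]
      have : (fun x : ∀ i, α i => ∫⁻ y, ∏ j ∈ insert i s, f j (Function.update x i y j) ∂μ i) =
          fun x => (∫⁻ y, f i y ∂μ i) * ∏ j ∈ s, f j (x j) := by
        funext x
        rw [← lintegral_mul_const _ (hf i)]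
        refine lintegral_congr fun y => ?_
        rw [Finset.prod_insert hi, Function.update_self]
        congr 1
        refine Finset.prod_congr rfl fun j hj => ?_
        rw [Function.update_of_ne (by rintro rfl; exact hi hj)]
      rw [this]
      unfold lmarginal
      rw [lintegral_const_mul]
      exact (hm s).comp measurable_updateFinset
  by_cases hne : Nonempty (∀ i, α i)
  · obtain ⟨x⟩ := hne
    rw [lintegral_eq_lmarginal_univ x]
    exact key Finset.univ x
  · obtain ⟨i, hi⟩ : ∃ i, IsEmpty (α i) := by
      by_contra! h
      exact hne inferInstance
    have : IsEmpty (∀ i, α i) := not_nonempty_iff.mp hne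
    rw [lintegral_of_isEmpty, Finset.prod_eq_zero (Finset.mem_univ i)]
    rw [lintegral_of_isEmpty]

/-- A finite product of measures with densities has the product density. -/
theorem pi_withDensity {ι : Type*} [Fintype ι] {α : ι → Type*}
    [∀ i, MeasurableSpace (α i)] (μ : ∀ i, Measure (α i)) [∀ i, SigmaFinite (μ i)]
    {f : ∀ i, α i → ENNReal} (hf : ∀ i, Measurable (f i))
    [∀ i, SigmaFinite ((μ i).withDensity (f i))] :
    Measure.pi (fun i => (μ i).withDensity (f i)) =
      (Measure.pi μ).withDensity fun x => ∏ i, f i (x i) := by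
  refine Measure.pi_eq fun s hs => ?_
  rw [withDensity_apply _ (MeasurableSet.univ_pi hs), Measure.restrict_pi_pi,
    lintegral_pi_prod_eq_prod _ hf]
  exact Finset.prod_congr rfl fun i _ => (withDensity_apply _ (hs i)).symm

/-- Averaging over the `i`th coordinate first does not change an integral against a product of
probability measures. -/
theorem lintegral_pi_update {ι : Type*} [Fintype ι] [DecidableEq ι] {α : Type*}
    [MeasurableSpace α] (μ : Measure α) [IsProbabilityMeasure μ] (i : ι)
    {f : (ι → α) → ENNReal} (hf : Measurable f) :
    ∫⁻ x, f x ∂Measure.pi (fun _ : ι => μ) =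
      ∫⁻ x, ∫⁻ y, f (Function.update x i y) ∂μ ∂Measure.pi (fun _ : ι => μ) := by
  have : Nonempty α := nonempty_of_isProbabilityMeasure μ
  obtain ⟨x⟩ : Nonempty (ι → α) := inferInstance
  have h1 : Measurable fun x : ι → α => ∫⁻ y, f (Function.update x i y) ∂μ := by
    refine Measurable.lintegral_prod_right'
      (f := fun p : (ι → α) × α => f (Function.update p.1 i p.2)) ?_
    refine hf.comp ?_
    rw [measurable_pi_iff]
    intro j
    by_cases h : j = i
    · subst h; simpa using measurable_snd
    · simp only [Function.update_of_ne h]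
      exact (measurable_pi_apply j).comp measurable_fst
  rw [lintegral_eq_lmarginal_univ x, lintegral_eq_lmarginal_univ x,
    ← Finset.insert_erase (Finset.mem_univ i),
    lmarginal_insert' _ hf (Finset.notMem_erase _ _),
    lmarginal_insert' _ h1 (Finset.notMem_erase _ _)]
  simp

/-- If a linear isomorphism turns one probability density into a multiple of another, then it
transports the corresponding laws: the Jacobian needs no computation, because both measures have
total mass one. -/
theorem map_withDensity_of_comp_eq {E F : Type*} [NormedAddCommGroup E] [NormedSpace ℝ E]
    [FiniteDimensional ℝ E] [MeasurableSpace E] [BorelSpace E] [NormedAddCommGroup F]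
    [NormedSpace ℝ F] [FiniteDimensional ℝ F] [MeasurableSpace F] [BorelSpace F]
    (μ : Measure E) [μ.IsAddHaarMeasure] (ν : Measure F) [ν.IsAddHaarMeasure] (L : E ≃L[ℝ] F)
    {f : F → ENNReal} (hf : Measurable f) {g : E → ENNReal} (c : ENNReal)
    (hg : ∀ x, g x = c * f (L x))
    [IsProbabilityMeasure (μ.withDensity g)] [IsProbabilityMeasure (ν.withDensity f)] :
    (μ.withDensity g).map L = ν.withDensity f := by
  have hL : Measurable L := L.continuous.measurable
  obtain ⟨k, hk⟩ : ∃ k : NNReal, μ.map L = k • ν :=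
    ⟨_, Measure.isAddLeftInvariant_eq_smul (μ.map L) ν⟩
  have hgf : g = fun x => c * f (L x) := funext hg
  have h : (μ.withDensity g).map L = (c * k) • ν.withDensity f := by
    ext s hs
    rw [Measure.map_apply hL hs, withDensity_apply _ (hL hs), Measure.smul_apply,
      withDensity_apply _ hs, hgf]
    change ∫⁻ x in L ⁻¹' s, c * f (L x) ∂μ = _
    rw [lintegral_const_mul c (f := fun x => f (L x)) (hf.comp hL),
      ← setLIntegral_map hs hf hL, hk, Measure.restrict_smul, lintegral_smul_measure,
      smul_eq_mul, mul_assoc]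
    rfl
  have h1 : c * k = 1 := by
    have := congrArg (fun m => m Set.univ) h
    simpa [Measure.map_apply hL MeasurableSet.univ] using this.symm
  rw [h, h1, one_smul]

theorem isAddHaarMeasure_volume_pi_pi (ι κ : Type*) [Fintype ι] [Fintype κ] :
    (volume : Measure (ι → κ → ℂ)).IsAddHaarMeasure :=
  Measure.pi.isAddHaarMeasure fun _ : ι => (volume : Measure (κ → ℂ))

/-! ### Gamma integrals and homogeneous functions -/

/-- The gamma integral `∫₀^∞ t^(a-1) e^(-rt) dt = r^(-a) Γ(a)` as a lower integral. -/
theorem lintegral_rpow_mul_exp_neg_mul_Ioi {a r : ℝ} (ha : 0 < a) (hr : 0 < r) :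
    ∫⁻ t in Set.Ioi (0 : ℝ), ENNReal.ofReal (t ^ (a - 1) * Real.exp (-(r * t))) =
      ENNReal.ofReal (r ^ (-a) * Real.Gamma a) := by
  have h := Real.integral_rpow_mul_exp_neg_mul_Ioi ha hr
  have hpos : 0 < (1 / r) ^ a * Real.Gamma a :=
    mul_pos (Real.rpow_pos_of_pos (by positivity) _) (Real.Gamma_pos_of_pos ha)
  have hint : IntegrableOn (fun t : ℝ => t ^ (a - 1) * Real.exp (-(r * t))) (Set.Ioi 0) := by
    by_contra hni
    rw [integral_undef hni] at h
    exact hpos.ne h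
  rw [← ofReal_integral_eq_lintegral_ofReal hint, h, one_div, Real.inv_rpow hr.le,
    Real.rpow_neg hr.le]
  filter_upwards [ae_restrict_mem measurableSet_Ioi] with t ht
  exact mul_nonneg (Real.rpow_nonneg (le_of_lt ht) _) (Real.exp_nonneg _)

theorem lintegral_exp_neg_mul_Ioi_one {r : ℝ} (hr : 0 < r) :
    ∫⁻ a in Set.Ioi (1 : ℝ), ENNReal.ofReal (r * Real.exp (-(a * r))) =
      ENNReal.ofReal (Real.exp (-r)) := by
  have h := integral_exp_mul_Ioi (neg_neg_of_pos hr) 1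
  have hint : IntegrableOn (fun a : ℝ => Real.exp (-r * a)) (Set.Ioi 1) :=
    integrableOn_exp_mul_Ioi (neg_neg_of_pos hr) 1
  have h2 : ∫ a in Set.Ioi (1 : ℝ), r * Real.exp (-(a * r)) = Real.exp (-r) := by
    have : (fun a : ℝ => r * Real.exp (-(a * r))) = fun a => r * Real.exp (-r * a) := by
      funext a; ring_nf
    rw [this, integral_const_mul, h]
    field_simp
  rw [← h2, ofReal_integral_eq_lintegral_ofReal]
  · refine (hint.const_mul r).congr (ae_of_all _ fun a => ?_)
    change r * Real.exp (-r * a) = r * Real.exp (-(a * r))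
    ring_nf
  · exact ae_of_all _ fun a => mul_nonneg hr.le (Real.exp_nonneg _)

theorem lintegral_rpow_Ioi_one {α : ℝ} (hα : 0 < α) :
    ∫⁻ a in Set.Ioi (1 : ℝ), ENNReal.ofReal (a ^ (-(α + 1))) = ENNReal.ofReal α⁻¹ := by
  rw [← ofReal_integral_eq_lintegral_ofReal
    (integrableOn_Ioi_rpow_of_lt (by linarith) one_pos)]
  · rw [integral_Ioi_rpow_of_lt (by linarith) one_pos]
    simp only [Real.one_rpow]
    congr 1
    have : -(α + 1) + 1 = -α := by ring
    rw [this, neg_div_neg_eq, one_div]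
  · filter_upwards [ae_restrict_mem measurableSet_Ioi] with a ha
    exact Real.rpow_nonneg (zero_le_one.trans (le_of_lt ha)) _

section Homogeneous

variable {E : Type*} [NormedAddCommGroup E] [NormedSpace ℝ E] [FiniteDimensional ℝ E]
  [MeasurableSpace E] [BorelSpace E]

theorem lintegral_comp_smul_addHaar (μ : Measure E) [μ.IsAddHaarMeasure] {t : ℝ} (ht : 0 < t)
    {f : E → ENNReal} (hf : Measurable f) :
    ∫⁻ z, f z ∂μ = ENNReal.ofReal (t ^ Module.finrank ℝ E) * ∫⁻ z, f (t • z) ∂μ := by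
  rw [← lintegral_map (g := fun z : E => t • z) hf (measurable_const_smul t),
    Measure.map_addHaar_smul μ ht.ne', lintegral_smul_measure, smul_eq_mul, ← mul_assoc,
    ← ENNReal.ofReal_mul (by positivity), abs_of_pos (by positivity),
    mul_inv_cancel₀ (by positivity), ENNReal.ofReal_one, one_mul]

/-- Integration by parts in the radial direction. If `q` is homogeneous of degree `2` and `g` is
homogeneous of degree `2β`, then an extra factor `q` in the integral of `g e^(-q)` amounts to the
constant `dim E / 2 + β`. The lower integral is scaled by `a^(-1/2)` in the identity
`e^(-q) = ∫₁^∞ q e^(-aq) da`, so that no integrability is needed. -/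
theorem lintegral_mul_exp_neg_of_homogeneous (μ : Measure E) [μ.IsAddHaarMeasure] {q : E → ℝ}
    (hqm : Measurable q) (hq : ∀ᵐ z ∂μ, 0 < q z)
    (hqs : ∀ t : ℝ, 0 < t → ∀ z, q (t • z) = t ^ 2 * q z) {g : E → ENNReal} (hg : Measurable g)
    {β α : ℝ} (hgs : ∀ t : ℝ, 0 < t → ∀ z, g (t • z) = ENNReal.ofReal (t ^ (2 * β)) * g z)
    (hα : α = Module.finrank ℝ E / 2 + β) (hα0 : 0 < α) :
    ∫⁻ z, ENNReal.ofReal (q z * Real.exp (-q z)) * g z ∂μ =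
      ENNReal.ofReal α * ∫⁻ z, ENNReal.ofReal (Real.exp (-q z)) * g z ∂μ := by
  set M := ∫⁻ z, ENNReal.ofReal (q z * Real.exp (-q z)) * g z ∂μ with hM
  have hscale : ∀ a : ℝ, 0 < a →
      ∫⁻ z, ENNReal.ofReal (q z * Real.exp (-(a * q z))) * g z ∂μ =
        ENNReal.ofReal (a ^ (-(α + 1))) * M := by
    intro a ha
    have ht : 0 < a ^ (-(1 / 2) : ℝ) := Real.rpow_pos_of_pos ha _
    have hsq : (a ^ (-(1 / 2) : ℝ)) ^ 2 = a⁻¹ := by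
      rw [← Real.rpow_natCast, ← Real.rpow_mul ha.le, ← Real.rpow_neg_one]
      norm_num
    have hmeas : Measurable fun z => ENNReal.ofReal (q z * Real.exp (-(a * q z))) * g z :=
      ((hqm.mul (hqm.const_mul a).neg.exp).ennreal_ofReal).mul hg
    rw [lintegral_comp_smul_addHaar μ ht hmeas, hM, ← lintegral_const_mul, ← lintegral_const_mul]
    · refine lintegral_congr fun z => ?_
      rw [hqs _ ht, hgs _ ht, hsq]
      have e1 : a * (a⁻¹ * q z) = q z := by field_simp
      rw [e1, mul_assoc a⁻¹, ENNReal.ofReal_mul (by positivity : 0 ≤ a⁻¹)]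
      have e2 : a ^ (-(α + 1)) = (a ^ (-(1 / 2) : ℝ)) ^ Module.finrank ℝ E *
          (a⁻¹ * (a ^ (-(1 / 2) : ℝ)) ^ (2 * β)) := by
        rw [← Real.rpow_natCast, ← Real.rpow_mul ha.le, ← Real.rpow_mul ha.le,
          ← Real.rpow_neg_one, ← Real.rpow_add ha, ← Real.rpow_add ha, hα]
        congr 1
        ring
      have hb1 : 0 ≤ (a ^ (-(1 / 2) : ℝ)) ^ Module.finrank ℝ E := by positivity
      have hb2 : 0 ≤ a⁻¹ := by positivity
      rw [e2, ENNReal.ofReal_mul hb1, ENNReal.ofReal_mul hb2]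
      ring
    · exact ((hqm.mul hqm.neg.exp).ennreal_ofReal).mul hg
    · exact hmeas.comp (measurable_const_smul _)
  have h0 : ∫⁻ z, ENNReal.ofReal (Real.exp (-q z)) * g z ∂μ = ENNReal.ofReal α⁻¹ * M := by
    calc ∫⁻ z, ENNReal.ofReal (Real.exp (-q z)) * g z ∂μ
        = ∫⁻ z, (∫⁻ a in Set.Ioi (1 : ℝ),
            ENNReal.ofReal (q z * Real.exp (-(a * q z))) * g z) ∂μ := by
          refine lintegral_congr_ae ?_
          filter_upwards [hq] with z hz
          rw [lintegral_mul_const _ (by fun_prop), lintegral_exp_neg_mul_Ioi_one hz]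
      _ = ∫⁻ a in Set.Ioi (1 : ℝ),
            ∫⁻ z, ENNReal.ofReal (q z * Real.exp (-(a * q z))) * g z ∂μ := by
          refine lintegral_lintegral_swap (Measurable.aemeasurable ?_)
          have hq1 : Measurable fun p : E × ℝ => q p.1 := hqm.comp measurable_fst
          exact ((hq1.mul (measurable_snd.mul hq1).neg.exp).ennreal_ofReal).mul
            (hg.comp measurable_fst)
      _ = ∫⁻ a in Set.Ioi (1 : ℝ), ENNReal.ofReal (a ^ (-(α + 1))) * M :=
          setLIntegral_congr_fun measurableSet_Ioi fun a ha =>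
            hscale a (zero_lt_one.trans ha)
      _ = ENNReal.ofReal α⁻¹ * M := by
          rw [lintegral_mul_const _ (by fun_prop), lintegral_rpow_Ioi_one hα0]
  rw [h0, ← mul_assoc, ← ENNReal.ofReal_mul hα0.le, mul_inv_cancel₀ hα0.ne', ENNReal.ofReal_one,
    one_mul]

/-- Under the density `e^(-q)`, weighting by a function homogeneous of degree `2β` gives `q` the
moments of a gamma variable of shape `dim E / 2 + β`. -/
theorem lintegral_pow_mul_exp_neg_of_homogeneous (μ : Measure E) [μ.IsAddHaarMeasure] {q : E → ℝ}
    (hqm : Measurable q) (hq : ∀ᵐ z ∂μ, 0 < q z) (hq0 : ∀ z, 0 ≤ q z)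
    (hqs : ∀ t : ℝ, 0 < t → ∀ z, q (t • z) = t ^ 2 * q z) {g : E → ENNReal} (hg : Measurable g)
    {β α : ℝ} (hgs : ∀ t : ℝ, 0 < t → ∀ z, g (t • z) = ENNReal.ofReal (t ^ (2 * β)) * g z)
    (hα : α = Module.finrank ℝ E / 2 + β) (hα0 : 0 < α) (k : ℕ) :
    ∫⁻ z, ENNReal.ofReal (Real.exp (-q z)) * (ENNReal.ofReal (q z ^ k) * g z) ∂μ =
      ENNReal.ofReal (Real.Gamma (α + k) / Real.Gamma α) *
        ∫⁻ z, ENNReal.ofReal (Real.exp (-q z)) * g z ∂μ := by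
  have hΓ : 0 < Real.Gamma α := Real.Gamma_pos_of_pos hα0
  induction k with
  | zero => simp [hΓ.ne']
  | succ k ih =>
    have hgs' : ∀ t : ℝ, 0 < t → ∀ z, ENNReal.ofReal (q (t • z) ^ k) * g (t • z) =
        ENNReal.ofReal (t ^ (2 * (β + k))) * (ENNReal.ofReal (q z ^ k) * g z) := by
      intro t ht z
      have e : t ^ (2 * (β + k)) = (t ^ 2) ^ k * t ^ (2 * β) := by
        rw [← pow_mul, ← Real.rpow_natCast, ← Real.rpow_add ht]
        congr 1
        push_cast
        ring
      rw [hqs t ht, hgs t ht, mul_pow, e, ENNReal.ofReal_mul (by positivity),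
        ENNReal.ofReal_mul (by positivity)]
      ring
    have h := lintegral_mul_exp_neg_of_homogeneous μ hqm hq hqs
      (g := fun z => ENNReal.ofReal (q z ^ k) * g z) ((hqm.pow_const k).ennreal_ofReal.mul hg)
      (β := β + k) (α := α + k) hgs' (by rw [hα]; ring) (by positivity)
    rw [ih, ← mul_assoc, ← ENNReal.ofReal_mul (by positivity)] at h
    have e : Real.Gamma (α + (k + 1 : ℕ)) / Real.Gamma α =
        (α + k) * (Real.Gamma (α + k) / Real.Gamma α) := by
      push_cast
      rw [← add_assoc, Real.Gamma_add_one (by positivity)]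
      ring
    rw [e, ← h]
    refine lintegral_congr fun z => ?_
    rw [pow_succ', ENNReal.ofReal_mul (hq0 z), ENNReal.ofReal_mul (hq0 z)]
    ring

end Homogeneous

/-! ### Standard complex Gaussian vectors and matrices -/

/-- The law on `ℂ` with density `π⁻¹ exp(-|z|²)`. -/
noncomputable def stdComplexNormal : Measure ℂ :=
  (volume : Measure ℂ).withDensity fun z => ENNReal.ofReal (Real.exp (-‖z‖ ^ 2) / Real.pi)

/-- The law of a vector of independent standard complex Gaussian entries. -/
noncomputable def stdComplexVector (κ : Type*) [Fintype κ] : Measure (κ → ℂ) :=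
  Measure.pi fun _ => stdComplexNormal

/-- The law of a family of independent standard complex Gaussian vectors, regarded as the rows of
a matrix. Plain functions are used because `Matrix` carries no σ-algebra. -/
noncomputable def stdComplexMatrix (ι κ : Type*) [Fintype ι] [Fintype κ] :
    Measure (ι → κ → ℂ) :=
  Measure.pi fun _ => stdComplexVector κ

theorem lintegral_exp_neg_mul_norm_sq {a : ℝ} (ha : 0 < a) :
    ∫⁻ z : ℂ, ENNReal.ofReal (Real.exp (-(a * ‖z‖ ^ 2))) = ENNReal.ofReal (Real.pi / a) := by
  have h := Complex.integral_exp_neg_mul_rpow (p := 2) one_le_two ha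
  have e : (fun z : ℂ => Real.exp (-a * ‖z‖ ^ (2 : ℝ))) = fun z => Real.exp (-(a * ‖z‖ ^ 2)) := by
    funext z
    rw [Real.rpow_two, neg_mul]
  have e2 : Real.pi * a ^ (-2 / 2 : ℝ) * Real.Gamma (2 / 2 + 1) = Real.pi / a := by
    norm_num [Real.rpow_neg_one]
    rfl
  rw [e, e2] at h
  have hint : Integrable fun z : ℂ => Real.exp (-(a * ‖z‖ ^ 2)) := by
    by_contra hni
    rw [integral_undef hni] at h
    exact (div_pos Real.pi_pos ha).ne h
  rw [← ofReal_integral_eq_lintegral_ofReal hint (ae_of_all _ fun _ => Real.exp_nonneg _), h]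

theorem measurable_stdComplexNormal_density :
    Measurable fun z : ℂ => ENNReal.ofReal (Real.exp (-‖z‖ ^ 2) / Real.pi) := by fun_prop

/-- The Laplace transform of the squared modulus of a standard complex Gaussian variable. -/
theorem lintegral_exp_neg_mul_norm_sq_stdComplexNormal {a : ℝ} (ha : 0 ≤ a) :
    ∫⁻ z, ENNReal.ofReal (Real.exp (-(a * ‖z‖ ^ 2))) ∂stdComplexNormal =
      ENNReal.ofReal (1 + a)⁻¹ := by
  have h1 : 0 < 1 + a := by positivity
  rw [stdComplexNormal, lintegral_withDensity_eq_lintegral_mul _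
    measurable_stdComplexNormal_density (by fun_prop)]
  have e : ∀ z : ℂ, ENNReal.ofReal (Real.exp (-‖z‖ ^ 2) / Real.pi) *
      ENNReal.ofReal (Real.exp (-(a * ‖z‖ ^ 2))) =
        ENNReal.ofReal Real.pi⁻¹ * ENNReal.ofReal (Real.exp (-((1 + a) * ‖z‖ ^ 2))) := by
    intro z
    rw [← ENNReal.ofReal_mul (by positivity), ← ENNReal.ofReal_mul (by positivity)]
    congr 1
    rw [div_mul_eq_mul_div, ← Real.exp_add, div_eq_inv_mul]
    ring_nf
  simp only [Pi.mul_apply, e]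
  rw [lintegral_const_mul _ (by fun_prop), lintegral_exp_neg_mul_norm_sq h1,
    ← ENNReal.ofReal_mul (by positivity)]
  congr 1
  field_simp

instance isProbabilityMeasure_stdComplexNormal : IsProbabilityMeasure stdComplexNormal := by
  constructor
  have h := lintegral_exp_neg_mul_norm_sq_stdComplexNormal le_rfl
  simpa using h

instance isProbabilityMeasure_stdComplexVector (κ : Type*) [Fintype κ] :
    IsProbabilityMeasure (stdComplexVector κ) := by
  unfold stdComplexVector; infer_instance

instance isProbabilityMeasure_stdComplexMatrix (ι κ : Type*) [Fintype ι] [Fintype κ] :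
    IsProbabilityMeasure (stdComplexMatrix ι κ) := by
  unfold stdComplexMatrix; infer_instance

theorem prod_ofReal_exp_neg_div {κ : Type*} [Fintype κ] (q : κ → ℝ) {c : ℝ} (hc : 0 ≤ c) :
    ∏ l, ENNReal.ofReal (Real.exp (-q l) / c) =
      ENNReal.ofReal (Real.exp (-∑ l, q l) / c ^ Fintype.card κ) := by
  rw [← ENNReal.ofReal_prod_of_nonneg fun l _ => by positivity, Finset.prod_div_distrib,
    ← Real.exp_sum, Finset.sum_neg_distrib, Finset.prod_const, Finset.card_univ]

theorem stdComplexVector_eq_withDensity (κ : Type*) [Fintype κ] :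
    stdComplexVector κ = (volume : Measure (κ → ℂ)).withDensity fun z =>
      ENNReal.ofReal (Real.exp (-∑ l, ‖z l‖ ^ 2) / Real.pi ^ Fintype.card κ) := by
  have := isProbabilityMeasure_stdComplexNormal
  unfold stdComplexNormal at this
  unfold stdComplexVector stdComplexNormal
  rw [pi_withDensity (fun _ : κ => (volume : Measure ℂ))
    fun _ => measurable_stdComplexNormal_density, volume_pi]
  congr 1
  funext z
  exact prod_ofReal_exp_neg_div (fun l => ‖z l‖ ^ 2) Real.pi_nonneg

theorem stdComplexMatrix_eq_withDensity (ι κ : Type*) [Fintype ι] [Fintype κ] :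
    stdComplexMatrix ι κ = (volume : Measure (ι → κ → ℂ)).withDensity fun Z =>
      ENNReal.ofReal (Real.exp (-∑ i, ∑ l, ‖Z i l‖ ^ 2) /
        (Real.pi ^ Fintype.card κ) ^ Fintype.card ι) := by
  have := isProbabilityMeasure_stdComplexVector κ
  unfold stdComplexMatrix
  rw [stdComplexVector_eq_withDensity] at this ⊢
  rw [pi_withDensity (fun _ : ι => (volume : Measure (κ → ℂ))) fun _ => by fun_prop,
    volume_pi (ι := ι)]
  congr 1
  funext Z
  exact prod_ofReal_exp_neg_div (fun i => ∑ l, ‖Z i l‖ ^ 2) (by positivity)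

theorem norm_sq_smul (t : ℝ) (z : ℂ) : ‖t • z‖ ^ 2 = t ^ 2 * ‖z‖ ^ 2 := by
  rw [norm_smul, mul_pow, Real.norm_eq_abs, sq_abs]

/-- The moment comparison for a Gaussian law with density proportional to `e^(-q)`. -/
theorem lintegral_pow_mul_withDensity_of_homogeneous {E : Type*} [NormedAddCommGroup E]
    [NormedSpace ℝ E] [FiniteDimensional ℝ E] [MeasurableSpace E] [BorelSpace E]
    (μ : Measure E) [μ.IsAddHaarMeasure] {q : E → ℝ}
    (hqm : Measurable q) (hq : ∀ᵐ z ∂μ, 0 < q z) (hq0 : ∀ z, 0 ≤ q z)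
    (hqs : ∀ t : ℝ, 0 < t → ∀ z, q (t • z) = t ^ 2 * q z) {g : E → ENNReal} (hg : Measurable g)
    {β α C : ℝ} (hgs : ∀ t : ℝ, 0 < t → ∀ z, g (t • z) = ENNReal.ofReal (t ^ (2 * β)) * g z)
    (hα : α = Module.finrank ℝ E / 2 + β) (hα0 : 0 < α) (k : ℕ) :
    ∫⁻ z, ENNReal.ofReal (q z ^ k) * g z
        ∂μ.withDensity (fun z => ENNReal.ofReal (Real.exp (-q z) / C)) =
      ENNReal.ofReal (Real.Gamma (α + k) / Real.Gamma α) *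
        ∫⁻ z, g z ∂μ.withDensity (fun z => ENNReal.ofReal (Real.exp (-q z) / C)) := by
  have hd : Measurable fun z => ENNReal.ofReal (Real.exp (-q z) / C) :=
    (hqm.neg.exp.div_const C).ennreal_ofReal
  have he : Measurable fun z => ENNReal.ofReal (Real.exp (-q z)) := hqm.neg.exp.ennreal_ofReal
  have hk : Measurable fun z => ENNReal.ofReal (q z ^ k) * g z :=
    (hqm.pow_const k).ennreal_ofReal.mul hg
  have e : ∀ f : E → ENNReal, Measurable f →
      ∫⁻ z, f z ∂μ.withDensity (fun z => ENNReal.ofReal (Real.exp (-q z) / C)) =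
        ENNReal.ofReal C⁻¹ * ∫⁻ z, ENNReal.ofReal (Real.exp (-q z)) * f z ∂μ := by
    intro f hf
    rw [lintegral_withDensity_eq_lintegral_mul _ hd hf,
      ← lintegral_const_mul' _ _ ENNReal.ofReal_ne_top]
    refine lintegral_congr fun z => ?_
    rw [Pi.mul_apply, div_eq_mul_inv, ENNReal.ofReal_mul (Real.exp_nonneg _)]
    ring
  rw [e _ hk, e _ hg, lintegral_pow_mul_exp_neg_of_homogeneous μ hqm hq hq0 hqs hg hgs hα hα0 k]
  ring

/-- For a standard complex Gaussian vector of dimension `d`, weighting by a function homogeneous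
of degree `2β` turns `‖z‖²` into a gamma variable of shape `d + β`. -/
theorem lintegral_norm_sq_pow_mul_stdComplexVector {κ : Type*} [Fintype κ] [Nonempty κ]
    {g : (κ → ℂ) → ENNReal} (hg : Measurable g) {β α : ℝ}
    (hgs : ∀ t : ℝ, 0 < t → ∀ z, g (t • z) = ENNReal.ofReal (t ^ (2 * β)) * g z)
    (hα : α = Fintype.card κ + β) (hα0 : 0 < α) (k : ℕ) :
    ∫⁻ z, ENNReal.ofReal ((∑ l, ‖z l‖ ^ 2) ^ k) * g z ∂stdComplexVector κ =
      ENNReal.ofReal (Real.Gamma (α + k) / Real.Gamma α) * ∫⁻ z, g z ∂stdComplexVector κ := by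
  rw [stdComplexVector_eq_withDensity]
  refine lintegral_pow_mul_withDensity_of_homogeneous volume (by fun_prop) ?_
    (fun z => by positivity) ?_ hg hgs ?_ hα0 k
  · have h0 : ∀ᵐ z : κ → ℂ, z ≠ 0 := by
      simp [ae_iff]
    filter_upwards [h0] with z hz
    obtain ⟨l, hl⟩ := Function.ne_iff.mp hz
    exact Finset.sum_pos' (fun _ _ => by positivity)
      ⟨l, Finset.mem_univ l, pow_pos (norm_pos_iff.mpr hl) 2⟩
  · intro t _ z
    simp only [Pi.smul_apply, norm_sq_smul, Finset.mul_sum]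
  · rw [hα, Module.finrank_pi_fintype]
    simp

/-- The analogue for all the entries of a standard complex Gaussian matrix together. -/
theorem lintegral_norm_sq_pow_mul_stdComplexMatrix {ι κ : Type*} [Fintype ι] [Nonempty ι]
    [Fintype κ] [Nonempty κ]
    {g : (ι → κ → ℂ) → ENNReal} (hg : Measurable g) {β α : ℝ}
    (hgs : ∀ t : ℝ, 0 < t → ∀ z, g (t • z) = ENNReal.ofReal (t ^ (2 * β)) * g z)
    (hα : α = Fintype.card ι * Fintype.card κ + β) (hα0 : 0 < α) (k : ℕ) :
    ∫⁻ Z, ENNReal.ofReal ((∑ i, ∑ l, ‖Z i l‖ ^ 2) ^ k) * g Z ∂stdComplexMatrix ι κ =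
      ENNReal.ofReal (Real.Gamma (α + k) / Real.Gamma α) * ∫⁻ Z, g Z ∂stdComplexMatrix ι κ := by
  have := isAddHaarMeasure_volume_pi_pi ι κ
  rw [stdComplexMatrix_eq_withDensity]
  refine lintegral_pow_mul_withDensity_of_homogeneous volume (by fun_prop) ?_
    (fun z => by positivity) ?_ hg hgs ?_ hα0 k
  · have h0 : ∀ᵐ Z : ι → κ → ℂ, Z ≠ 0 := by
      simp [ae_iff]
    filter_upwards [h0] with Z hZ
    obtain ⟨i, hi⟩ := Function.ne_iff.mp hZ
    obtain ⟨l, hl⟩ := Function.ne_iff.mp hi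
    exact Finset.sum_pos' (fun _ _ => by positivity) ⟨i, Finset.mem_univ i,
      Finset.sum_pos' (fun _ _ => by positivity)
        ⟨l, Finset.mem_univ l, pow_pos (norm_pos_iff.mpr hl) 2⟩⟩
  · intro t _ z
    simp only [Pi.smul_apply, norm_sq_smul, Finset.mul_sum]
  · rw [hα, Module.finrank_pi_fintype]
    simp [Module.finrank_pi_fintype]
    ring

/-- If the weight `g` is homogeneous of degree `2β` in each row of a standard complex Gaussian
matrix with `d` columns, then the squared row norms behave as independent gamma variables of shape
`d + β`. -/
theorem lintegral_prod_row_norm_sq_pow_mul_stdComplexMatrix {ι κ : Type*} [Fintype ι]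
    [DecidableEq ι] [Fintype κ] [Nonempty κ]
    {g : (ι → κ → ℂ) → ENNReal} (hg : Measurable g) {β α : ℝ}
    (hgs : ∀ t : ℝ, 0 < t → ∀ Z i z,
      g (Function.update Z i (t • z)) = ENNReal.ofReal (t ^ (2 * β)) * g (Function.update Z i z))
    (hα : α = Fintype.card κ + β) (hα0 : 0 < α) (k : ι → ℕ) :
    ∫⁻ Z, ENNReal.ofReal (∏ i, (∑ l, ‖Z i l‖ ^ 2) ^ k i) * g Z ∂stdComplexMatrix ι κ =
      ENNReal.ofReal (∏ i, Real.Gamma (α + k i) / Real.Gamma α) *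
        ∫⁻ Z, g Z ∂stdComplexMatrix ι κ := by
  have hΓ : ∀ j : ℕ, 0 ≤ Real.Gamma (α + j) / Real.Gamma α := fun j =>
    (div_pos (Real.Gamma_pos_of_pos (by positivity)) (Real.Gamma_pos_of_pos hα0)).le
  have key : ∀ s : Finset ι,
      ∫⁻ Z, ENNReal.ofReal (∏ i ∈ s, (∑ l, ‖Z i l‖ ^ 2) ^ k i) * g Z ∂stdComplexMatrix ι κ =
      ENNReal.ofReal (∏ i ∈ s, Real.Gamma (α + k i) / Real.Gamma α) *
        ∫⁻ Z, g Z ∂stdComplexMatrix ι κ := by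
    intro s
    induction s using Finset.induction_on with
    | empty => simp
    | insert i s hi ih =>
      have hm : ∀ t : Finset ι, Measurable fun Z : ι → κ → ℂ =>
          ENNReal.ofReal (∏ i ∈ t, (∑ l, ‖Z i l‖ ^ 2) ^ k i) * g Z := fun t =>
        Measurable.mul (by fun_prop) hg
      rw [Finset.prod_insert hi, ENNReal.ofReal_mul (hΓ _), mul_assoc, ← ih]
      unfold stdComplexMatrix
      rw [lintegral_pi_update _ i (hm _), lintegral_pi_update _ i (hm _),
        ← lintegral_const_mul']
      swap
      · exact ENNReal.ofReal_ne_top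
      refine lintegral_congr fun Z => ?_
      have hu : ∀ z : κ → ℂ, ∏ j ∈ s, (∑ l, ‖Function.update Z i z j l‖ ^ 2) ^ k j =
          ∏ j ∈ s, (∑ l, ‖Z j l‖ ^ 2) ^ k j := fun z =>
        Finset.prod_congr rfl fun j hj => by
          rw [Function.update_of_ne (by rintro rfl; exact hi hj)]
      have hgm : Measurable fun z => g (Function.update Z i z) := hg.comp (measurable_update Z)
      simp only [Finset.prod_insert hi, hu, Function.update_self]
      rw [← lintegral_norm_sq_pow_mul_stdComplexVector
        (g := fun z => ENNReal.ofReal (∏ j ∈ s, (∑ l, ‖Z j l‖ ^ 2) ^ k j) *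
          g (Function.update Z i z)) (hgm.const_mul _) ?_ hα hα0 (k i)]
      · refine lintegral_congr fun z => ?_
        rw [ENNReal.ofReal_mul (by positivity), mul_assoc]
      · intro t ht z
        rw [hgs t ht]
        ring
  exact key Finset.univ

/-! ### Gram determinants -/

/-- The Gram determinant `det(Z Z†)` of the rows of `Z`. It is a nonnegative real number; the real
part only serves to land in `ℝ`. -/
noncomputable def gramDet {ι κ : Type*} [Fintype ι] [DecidableEq ι] [Fintype κ] (Z : ι → κ → ℂ) :
    ℝ :=
  (Matrix.of Z * (Matrix.of Z)ᴴ).det.re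

section GramDet

variable {ι κ : Type*} [Fintype ι] [DecidableEq ι] [Fintype κ]

theorem gramDet_nonneg (Z : ι → κ → ℂ) : 0 ≤ gramDet Z :=
  (Complex.le_def.mp (posSemidef_self_mul_conjTranspose (Matrix.of Z)).det_nonneg).1

theorem ofReal_gramDet (Z : ι → κ → ℂ) :
    (gramDet Z : ℂ) = (Matrix.of Z * (Matrix.of Z)ᴴ).det := by
  apply Complex.ext
  · rfl
  · exact (Complex.le_def.mp (posSemidef_self_mul_conjTranspose (Matrix.of Z)).det_nonneg).2

theorem measurable_gramDet : Measurable (gramDet : (ι → κ → ℂ) → ℝ) := by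
  have h : Continuous fun Z : ι → κ → ℂ => Matrix.of Z :=
    continuous_matrix fun i j => (continuous_apply j).comp (continuous_apply i)
  exact (Complex.continuous_re.comp (h.matrix_mul h.matrix_conjTranspose).matrix_det).measurable

theorem gramDet_of_mul (A : Matrix ι ι ℂ) (Z : ι → κ → ℂ) :
    gramDet (Matrix.of.symm (A * Matrix.of Z)) = ‖A.det‖ ^ 2 * gramDet Z := by
  have h : (gramDet (Matrix.of.symm (A * Matrix.of Z)) : ℂ) =
      ((‖A.det‖ ^ 2 * gramDet Z : ℝ) : ℂ) := by
    rw [ofReal_gramDet, Equiv.apply_symm_apply, conjTranspose_mul, Matrix.mul_assoc,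
      ← Matrix.mul_assoc (Matrix.of Z), det_mul, det_mul,
      det_conjTranspose, ← ofReal_gramDet]
    push_cast
    rw [← Complex.mul_conj']
    simp only [starRingEnd_apply]
    ring
  exact_mod_cast h

theorem gramDet_update_smul (t : ℝ) (Z : ι → κ → ℂ) (i : ι) (z : κ → ℂ) :
    gramDet (Function.update Z i (t • z)) = t ^ 2 * gramDet (Function.update Z i z) := by
  have h : Function.update Z i (t • z) =
      Matrix.of.symm (diagonal (Function.update (fun _ => (1 : ℂ)) i t) *
        Matrix.of (Function.update Z i z)) := by
    funext j l
    rw [of_symm_apply, diagonal_mul]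
    by_cases hj : j = i
    · subst hj; simp
    · simp [Function.update_of_ne hj]
  rw [h, gramDet_of_mul, det_diagonal, Finset.prod_update_of_mem (Finset.mem_univ i)]
  simp

theorem gramDet_smul (t : ℝ) (Z : ι → κ → ℂ) :
    gramDet (t • Z) = (t ^ 2) ^ Fintype.card ι * gramDet Z := by
  have h : t • Z =
      Matrix.of.symm ((diagonal fun _ : ι => (t : ℂ) : Matrix ι ι ℂ) * Matrix.of Z) := by
    funext j l
    rw [of_symm_apply, diagonal_mul]
    simp
  rw [h, gramDet_of_mul, det_diagonal, Finset.prod_const, Finset.card_univ, norm_pow,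
    Complex.norm_real, ← pow_mul, mul_comm (Fintype.card ι), pow_mul, Real.norm_eq_abs, sq_abs]

end GramDet

theorem exists_unitary_diagonalization {ι : Type*} [Fintype ι] [DecidableEq ι]
    {Q : Matrix ι ι ℂ} (hQ : Q.IsHermitian) :
    ∃ U : Matrix ι ι ℂ, U * Uᴴ = 1 ∧ Uᴴ * U = 1 ∧
      Q = U * diagonal (fun i => (hQ.eigenvalues i : ℂ)) * Uᴴ := by
  refine ⟨hQ.eigenvectorUnitary, ?_, ?_, ?_⟩
  · exact Unitary.mul_star_self_of_mem hQ.eigenvectorUnitary.2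
  · exact Unitary.star_mul_self_of_mem hQ.eigenvectorUnitary.2
  · conv_lhs => rw [hQ.spectral_theorem, Unitary.conjStarAlgAut_apply]
    rfl

/-- The quadratic form of a Hermitian projection is, in suitable orthonormal coordinates, a sum of
`trace` many squared moduli. -/
theorem exists_unitary_of_projection {κ : Type*} [Fintype κ] [DecidableEq κ]
    {Q : Matrix κ κ ℂ} (hQ : Q.IsHermitian) (hQ2 : Q * Q = Q) :
    ∃ (U : Matrix κ κ ℂ) (S : Finset κ), U * Uᴴ = 1 ∧ Uᴴ * U = 1 ∧ Q.trace = S.card ∧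
      ∀ z : κ → ℂ, (replicateRow Unit z * Q * (replicateRow Unit z)ᴴ) () () =
        ((∑ l ∈ S, ‖(z ᵥ* U) l‖ ^ 2 : ℝ) : ℂ) := by
  obtain ⟨U, hU1, hU2, hD⟩ := exists_unitary_diagonalization hQ
  set lam := hQ.eigenvalues
  have hlam : ∀ i, lam i = 0 ∨ lam i = 1 := by
    intro i
    have h : diagonal (fun i => (lam i : ℂ)) * diagonal (fun i => (lam i : ℂ)) =
        diagonal (fun i => (lam i : ℂ)) := by
      have e : diagonal (fun i => (lam i : ℂ)) = Uᴴ * Q * U := by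
        rw [hD]
        simp only [Matrix.mul_assoc, hU2, Matrix.mul_one]
        rw [← Matrix.mul_assoc, hU2, Matrix.one_mul]
      rw [e]
      calc Uᴴ * Q * U * (Uᴴ * Q * U) = Uᴴ * Q * (U * Uᴴ) * Q * U := by
            simp only [Matrix.mul_assoc]
        _ = Uᴴ * (Q * Q) * U := by rw [hU1, Matrix.mul_one, Matrix.mul_assoc Uᴴ]
        _ = Uᴴ * Q * U := by rw [hQ2]
    rw [diagonal_mul_diagonal] at h
    have h2 := congrFun (diagonal_injective h) i
    have h3 : lam i * lam i = lam i := by exact_mod_cast h2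
    have h4 : lam i * (lam i - 1) = 0 := by linarith
    rcases mul_eq_zero.mp h4 with h | h
    · exact Or.inl h
    · exact Or.inr (by linarith)
  refine ⟨U, Finset.univ.filter fun i => lam i = 1, hU1, hU2, ?_, fun z => ?_⟩
  · rw [hD, trace_mul_cycle, hU2, Matrix.one_mul, trace_diagonal, Finset.card_filter]
    push_cast
    refine Finset.sum_congr rfl fun i _ => ?_
    rcases hlam i with h | h <;> simp [h]
  · have e : replicateRow Unit z * Q * (replicateRow Unit z)ᴴ =
        (replicateRow Unit (z ᵥ* U)) * diagonal (fun i => (lam i : ℂ)) *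
          (replicateRow Unit (z ᵥ* U))ᴴ := by
      rw [replicateRow_vecMul, conjTranspose_mul, hD]
      simp only [Matrix.mul_assoc]
    rw [e, Finset.sum_filter, Matrix.mul_apply]
    push_cast
    refine Finset.sum_congr rfl fun l _ => ?_
    rw [mul_diagonal, conjTranspose_apply, replicateRow_apply]
    rcases hlam l with h | h
    · simp [h]
    · simp only [h, Complex.ofReal_one, mul_one, if_true]
      rw [Complex.ofReal_pow, ← Complex.mul_conj']
      rfl

/-- Adding a row `z` multiplies the Gram determinant by the squared distance of `z` from the span
of the other rows, which is a sum of `m - n` squared moduli in orthonormal coordinates that depend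
only on the other rows. -/
theorem exists_gramDet_cons_eq {n m : ℕ} (V : Fin n → Fin m → ℂ) (hV : gramDet V ≠ 0) :
    ∃ (U : Matrix (Fin m) (Fin m) ℂ) (S : Finset (Fin m)), U * Uᴴ = 1 ∧ Uᴴ * U = 1 ∧
      n + S.card = m ∧ ∀ z : Fin m → ℂ,
        gramDet (Fin.cons z V : Fin (n + 1) → Fin m → ℂ) =
          gramDet V * ∑ l ∈ S, ‖(z ᵥ* U) l‖ ^ 2 := by
  set A : Matrix (Fin n) (Fin m) ℂ := Matrix.of V
  have hdet : (A * Aᴴ).det ≠ 0 := by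
    rw [← ofReal_gramDet]
    exact_mod_cast hV
  have hu : IsUnit (A * Aᴴ).det := isUnit_iff_ne_zero.mpr hdet
  let _ : Invertible (A * Aᴴ) := invertibleOfIsUnitDet _ hu
  have hG : (A * Aᴴ)⁻¹.IsHermitian := (isHermitian_mul_conjTranspose_self A).inv
  -- The orthogonal projection onto the complement of the span of the rows, which enters through
  -- the Schur complement of the Gram matrix of `V`.
  set Q : Matrix (Fin m) (Fin m) ℂ := 1 - Aᴴ * (A * Aᴴ)⁻¹ * A with hQdef
  have hQ : Q.IsHermitian := by
    refine isHermitian_one.sub ?_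
    rw [IsHermitian, conjTranspose_mul, conjTranspose_mul, hG.eq, conjTranspose_conjTranspose,
      Matrix.mul_assoc]
  have hP : Aᴴ * (A * Aᴴ)⁻¹ * A * (Aᴴ * (A * Aᴴ)⁻¹ * A) = Aᴴ * (A * Aᴴ)⁻¹ * A := by
    calc Aᴴ * (A * Aᴴ)⁻¹ * A * (Aᴴ * (A * Aᴴ)⁻¹ * A)
        = Aᴴ * ((A * Aᴴ)⁻¹ * (A * Aᴴ)) * (A * Aᴴ)⁻¹ * A := by simp only [Matrix.mul_assoc]
      _ = Aᴴ * (A * Aᴴ)⁻¹ * A := by rw [nonsing_inv_mul _ hu, Matrix.mul_one]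
  have hQ2 : Q * Q = Q := by
    rw [hQdef, Matrix.sub_mul, Matrix.mul_sub, Matrix.one_mul, Matrix.mul_sub, hP]
    simp
  have htr : Q.trace = (m : ℂ) - n := by
    rw [hQdef, trace_sub, trace_one, trace_mul_cycle, mul_nonsing_inv _ hu, trace_one]
    simp
  obtain ⟨U, S, hU1, hU2, hS, hq⟩ := exists_unitary_of_projection hQ hQ2
  refine ⟨U, S, hU1, hU2, ?_, fun z => ?_⟩
  · rw [htr, sub_eq_iff_eq_add] at hS
    have : m = S.card + n := by exact_mod_cast hS
    omega
  · set B : Matrix (Fin (n + 1)) (Fin m) ℂ := Matrix.of (Fin.cons z V : Fin (n + 1) → Fin m → ℂ)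
    have hbij : Function.Bijective
        (Sum.elim (fun _ => 0) Fin.succ : Unit ⊕ Fin n → Fin (n + 1)) := by
      constructor
      · rintro (_ | i) (_ | j) h
        · rfl
        · exact absurd h (Fin.succ_ne_zero j).symm
        · exact absurd h (Fin.succ_ne_zero i)
        · exact congrArg _ (Fin.succ_injective _ h)
      · intro i
        refine Fin.cases ⟨Sum.inl (), rfl⟩ (fun j => ⟨Sum.inr j, rfl⟩) i
    have hb : (B * Bᴴ).submatrix (Equiv.ofBijective _ hbij) (Equiv.ofBijective _ hbij) =
        fromBlocks (replicateRow Unit z * (replicateRow Unit z)ᴴ) (replicateRow Unit z * Aᴴ)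
          (A * (replicateRow Unit z)ᴴ) (A * Aᴴ) := by
      ext (i | i) (j | j) <;> rfl
    have hc : (gramDet (Fin.cons z V : Fin (n + 1) → Fin m → ℂ) : ℂ) =
        ((gramDet V * ∑ l ∈ S, ‖(z ᵥ* U) l‖ ^ 2 : ℝ) : ℂ) := by
      rw [ofReal_gramDet, ← det_submatrix_equiv_self (Equiv.ofBijective _ hbij), hb,
        det_fromBlocks₂₂, det_unique (n := Unit), Complex.ofReal_mul, ← hq z, ofReal_gramDet]
      congr 1
      change (_ - _ : Matrix Unit Unit ℂ) () () = _
      rw [hQdef, Matrix.mul_sub, Matrix.sub_mul, Matrix.mul_one, invOf_eq_nonsing_inv]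
      simp only [Matrix.mul_assoc]
    exact_mod_cast hc

theorem gramDet_cons_eq_zero {n m : ℕ} {V : Fin n → Fin m → ℂ} (hV : gramDet V = 0)
    (z : Fin m → ℂ) : gramDet (Fin.cons z V : Fin (n + 1) → Fin m → ℂ) = 0 := by
  have h0 : (Matrix.of V * (Matrix.of V)ᴴ).det = 0 := by
    rw [← ofReal_gramDet, hV, Complex.ofReal_zero]
  obtain ⟨v, hv, hv0⟩ := exists_vecMul_eq_zero_iff.mpr h0
  have hvV : v ᵥ* Matrix.of V = 0 := vecMul_self_mul_conjTranspose_eq_zero _ _ |>.mp hv0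
  have h1 : (Matrix.of (Fin.cons z V : Fin (n + 1) → Fin m → ℂ) *
      (Matrix.of (Fin.cons z V : Fin (n + 1) → Fin m → ℂ))ᴴ).det = 0 := by
    refine exists_vecMul_eq_zero_iff.mp ⟨Fin.cons 0 v, fun h => hv ?_, ?_⟩
    · funext i
      simpa using congrFun h i.succ
    · rw [vecMul_self_mul_conjTranspose_eq_zero]
      funext l
      have := congrFun hvV l
      simp only [vecMul, dotProduct, of_apply, Pi.zero_apply] at this ⊢
      rw [Fin.sum_univ_succ]
      simpa using this
  rw [gramDet, h1, Complex.zero_re]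

/-! ### Negative moments of the Gram determinant of a standard Gaussian matrix -/

/-- The beta integral on the half-line, obtained by writing `(1 + a)^(-d)` as a gamma integral. -/
theorem lintegral_rpow_mul_one_add_rpow_neg {s d : ℝ} (hs : 0 < s) (hsd : s < d) :
    ∫⁻ a in Set.Ioi (0 : ℝ), ENNReal.ofReal (a ^ (s - 1)) * ENNReal.ofReal ((1 + a) ^ (-d)) =
      ENNReal.ofReal (Real.Gamma s) * ENNReal.ofReal (Real.Gamma (d - s) / Real.Gamma d) := by
  have hd : 0 < d := hs.trans hsd
  have hΓd : 0 < Real.Gamma d := Real.Gamma_pos_of_pos hd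
  have hmul : ENNReal.ofReal (Real.Gamma d) *
      ∫⁻ a in Set.Ioi (0 : ℝ), ENNReal.ofReal (a ^ (s - 1)) * ENNReal.ofReal ((1 + a) ^ (-d)) =
      ENNReal.ofReal (Real.Gamma s) * ENNReal.ofReal (Real.Gamma (d - s)) := by
    calc _ = ∫⁻ a in Set.Ioi (0 : ℝ), (∫⁻ b in Set.Ioi (0 : ℝ), ENNReal.ofReal (a ^ (s - 1)) *
            ENNReal.ofReal (b ^ (d - 1) * Real.exp (-((1 + a) * b)))) := by
          rw [← lintegral_const_mul _ (by fun_prop)]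
          refine setLIntegral_congr_fun measurableSet_Ioi fun a ha => ?_
          have ha' : 0 < 1 + a := by have := Set.mem_Ioi.mp ha; linarith
          rw [lintegral_const_mul _ (by fun_prop), lintegral_rpow_mul_exp_neg_mul_Ioi hd ha',
            ENNReal.ofReal_mul (by positivity)]
          ring
      _ = ∫⁻ b in Set.Ioi (0 : ℝ), (∫⁻ a in Set.Ioi (0 : ℝ), ENNReal.ofReal (a ^ (s - 1)) *
            ENNReal.ofReal (b ^ (d - 1) * Real.exp (-((1 + a) * b)))) := by
          refine lintegral_lintegral_swap (Measurable.aemeasurable ?_)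
          fun_prop
      _ = ∫⁻ b in Set.Ioi (0 : ℝ), ENNReal.ofReal (Real.Gamma s) *
            ENNReal.ofReal (b ^ (d - s - 1) * Real.exp (-(1 * b))) := by
          refine setLIntegral_congr_fun measurableSet_Ioi fun b hb => ?_
          have hb' : 0 < b := hb
          have e : ∫⁻ a in Set.Ioi (0 : ℝ), ENNReal.ofReal (a ^ (s - 1)) *
              ENNReal.ofReal (b ^ (d - 1) * Real.exp (-((1 + a) * b))) =
              ∫⁻ a in Set.Ioi (0 : ℝ), ENNReal.ofReal (b ^ (d - 1) * Real.exp (-(1 * b))) *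
                ENNReal.ofReal (a ^ (s - 1) * Real.exp (-(b * a))) := by
            refine setLIntegral_congr_fun measurableSet_Ioi fun a ha => ?_
            have ha' : 0 < a := ha
            rw [← ENNReal.ofReal_mul (by positivity), ← ENNReal.ofReal_mul (by positivity)]
            congr 1
            have : Real.exp (-((1 + a) * b)) = Real.exp (-(1 * b)) * Real.exp (-(b * a)) := by
              rw [← Real.exp_add]; ring_nf
            rw [this]
            ring
          rw [e, lintegral_const_mul _ (by fun_prop), lintegral_rpow_mul_exp_neg_mul_Ioi hs hb',
            ← ENNReal.ofReal_mul (by positivity), ← ENNReal.ofReal_mul (by positivity)]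
          congr 1
          have : b ^ (d - s - 1) = b ^ (d - 1) * b ^ (-s) := by
            rw [← Real.rpow_add hb']; ring_nf
          rw [this]
          ring
      _ = _ := by
          rw [lintegral_const_mul _ (by fun_prop),
            lintegral_rpow_mul_exp_neg_mul_Ioi (sub_pos.mpr hsd) one_pos, Real.one_rpow, one_mul]
  rw [div_eq_inv_mul, ENNReal.ofReal_mul (by positivity), mul_left_comm, ← hmul, ← mul_assoc,
    ← ENNReal.ofReal_mul (by positivity), inv_mul_cancel₀ hΓd.ne', ENNReal.ofReal_one, one_mul]

/-- The Laplace transform of the squared norm of some of the coordinates. -/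
theorem lintegral_exp_neg_mul_sum_stdComplexVector {κ : Type*} [Fintype κ]
    (S : Finset κ) {a : ℝ} (ha : 0 ≤ a) :
    ∫⁻ z, ENNReal.ofReal (Real.exp (-(a * ∑ l ∈ S, ‖z l‖ ^ 2))) ∂stdComplexVector κ =
      ENNReal.ofReal ((1 + a) ^ (-(S.card : ℝ))) := by
  classical
  have e : ∀ z : κ → ℂ, ENNReal.ofReal (Real.exp (-(a * ∑ l ∈ S, ‖z l‖ ^ 2))) =
      ∏ l, ENNReal.ofReal (Real.exp (-((if l ∈ S then a else 0) * ‖z l‖ ^ 2))) := by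
    intro z
    rw [← ENNReal.ofReal_prod_of_nonneg fun _ _ => Real.exp_nonneg _, ← Real.exp_sum,
      Finset.sum_neg_distrib, Finset.mul_sum]
    simp only [ite_mul, zero_mul, Finset.sum_ite_mem, Finset.univ_inter]
  simp only [e]
  unfold stdComplexVector
  rw [lintegral_pi_prod_eq_prod (fun _ : κ => stdComplexNormal) (f := fun l (z : ℂ) =>
    ENNReal.ofReal (Real.exp (-((if l ∈ S then a else 0) * ‖z‖ ^ 2)))) fun l => by fun_prop]
  have e2 : ∀ l, ∫⁻ z, ENNReal.ofReal (Real.exp (-((if l ∈ S then a else 0) * ‖z‖ ^ 2)))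
      ∂stdComplexNormal = if l ∈ S then ENNReal.ofReal (1 + a)⁻¹ else 1 := by
    intro l
    rw [lintegral_exp_neg_mul_norm_sq_stdComplexNormal (by split_ifs <;> simp [ha])]
    split_ifs <;> simp
  simp only [e2, Finset.prod_ite_mem, Finset.univ_inter, Finset.prod_const]
  rw [← ENNReal.ofReal_pow (by positivity), Real.rpow_neg (by positivity), Real.rpow_natCast,
    inv_pow]

/-- The negative moments of a squared norm of `d` standard coordinates, which is a gamma variable
of shape `d`. -/
theorem lintegral_sum_norm_sq_rpow_neg_stdComplexVector {κ : Type*} [Fintype κ]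
    (S : Finset κ) {s : ℝ} (hs : 0 < s) (hsS : s < S.card) :
    ∫⁻ z, ENNReal.ofReal ((∑ l ∈ S, ‖z l‖ ^ 2) ^ (-s)) ∂stdComplexVector κ =
      ENNReal.ofReal (Real.Gamma (S.card - s) / Real.Gamma S.card) := by
  have hΓs : 0 < Real.Gamma s := Real.Gamma_pos_of_pos hs
  have hpos : ∀ᵐ z ∂stdComplexVector κ, 0 < ∑ l ∈ S, ‖z l‖ ^ 2 := by
    obtain ⟨l, hl⟩ : S.Nonempty := by
      rw [← Finset.card_pos]
      exact_mod_cast hs.trans hsS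
    have : NullSingletonClass stdComplexNormal := by unfold stdComplexNormal; infer_instance
    filter_upwards [Measure.ae_eval_ne (μ := fun _ : κ => stdComplexNormal) l 0] with z hz
    exact Finset.sum_pos' (fun _ _ => by positivity) ⟨l, hl, pow_pos (norm_pos_iff.mpr hz) 2⟩
  have hmul : ENNReal.ofReal (Real.Gamma s) *
      ∫⁻ z, ENNReal.ofReal ((∑ l ∈ S, ‖z l‖ ^ 2) ^ (-s)) ∂stdComplexVector κ =
      ENNReal.ofReal (Real.Gamma s) *
        ENNReal.ofReal (Real.Gamma (S.card - s) / Real.Gamma S.card) := by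
    calc _ = ∫⁻ z, (∫⁻ a in Set.Ioi (0 : ℝ), ENNReal.ofReal
            (a ^ (s - 1) * Real.exp (-((∑ l ∈ S, ‖z l‖ ^ 2) * a)))) ∂stdComplexVector κ := by
          rw [← lintegral_const_mul _ (by fun_prop)]
          refine lintegral_congr_ae ?_
          filter_upwards [hpos] with z hz
          rw [lintegral_rpow_mul_exp_neg_mul_Ioi hs hz, mul_comm,
            ENNReal.ofReal_mul (by positivity)]
      _ = ∫⁻ a in Set.Ioi (0 : ℝ), (∫⁻ z, ENNReal.ofReal
            (a ^ (s - 1) * Real.exp (-((∑ l ∈ S, ‖z l‖ ^ 2) * a))) ∂stdComplexVector κ) := by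
          refine lintegral_lintegral_swap (Measurable.aemeasurable ?_)
          fun_prop
      _ = ∫⁻ a in Set.Ioi (0 : ℝ),
            ENNReal.ofReal (a ^ (s - 1)) * ENNReal.ofReal ((1 + a) ^ (-(S.card : ℝ))) := by
          refine setLIntegral_congr_fun measurableSet_Ioi fun a ha => ?_
          have ha' : 0 < a := ha
          rw [← lintegral_exp_neg_mul_sum_stdComplexVector S ha'.le,
            ← lintegral_const_mul _ (by fun_prop)]
          refine lintegral_congr fun z => ?_
          rw [ENNReal.ofReal_mul (by positivity), mul_comm a]
      _ = _ := lintegral_rpow_mul_one_add_rpow_neg hs hsS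
  exact (ENNReal.mul_right_inj (ENNReal.ofReal_pos.mpr hΓs).ne' ENNReal.ofReal_ne_top).mp hmul

theorem sum_norm_sq_eq_dotProduct {κ : Type*} [Fintype κ] (z : κ → ℂ) :
    ((∑ l, ‖z l‖ ^ 2 : ℝ) : ℂ) = star z ⬝ᵥ z := by
  simp only [dotProduct, Pi.star_apply]
  push_cast
  exact Finset.sum_congr rfl fun l _ => (Complex.conj_mul' _).symm

theorem sum_norm_sq_vecMul_unitary {κ : Type*} [Fintype κ] [DecidableEq κ]
    {U : Matrix κ κ ℂ} (hU : U * Uᴴ = 1) (z : κ → ℂ) :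
    ∑ l, ‖(z ᵥ* U) l‖ ^ 2 = ∑ l, ‖z l‖ ^ 2 := by
  have h : ((∑ l, ‖(z ᵥ* U) l‖ ^ 2 : ℝ) : ℂ) = ((∑ l, ‖z l‖ ^ 2 : ℝ) : ℂ) := by
    rw [sum_norm_sq_eq_dotProduct, sum_norm_sq_eq_dotProduct, star_vecMul, dotProduct_comm,
      ← dotProduct_mulVec, mulVec_mulVec, hU, one_mulVec, dotProduct_comm]
  exact_mod_cast h

/-- A standard complex Gaussian vector is invariant under unitary transformations. -/
theorem lintegral_comp_vecMul_unitary {κ : Type*} [Fintype κ] [DecidableEq κ]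
    {U : Matrix κ κ ℂ} (hU : U * Uᴴ = 1) (hU' : Uᴴ * U = 1) {f : (κ → ℂ) → ENNReal}
    (hf : Measurable f) :
    ∫⁻ z, f (z ᵥ* U) ∂stdComplexVector κ = ∫⁻ z, f z ∂stdComplexVector κ := by
  let L : (κ → ℂ) ≃L[ℝ] (κ → ℂ) := LinearEquiv.toContinuousLinearEquiv
    { toFun := fun z => z ᵥ* U
      map_add' := fun x y => add_vecMul _ _ _
      map_smul' := fun t x => smul_vecMul t x U
      invFun := fun z => z ᵥ* Uᴴ
      left_inv := fun z => by simp [hU]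
      right_inv := fun z => by simp [hU'] }
  have hL : ∀ z, L z = z ᵥ* U := fun _ => rfl
  have := isProbabilityMeasure_stdComplexVector κ
  rw [stdComplexVector_eq_withDensity] at this ⊢
  have h := map_withDensity_of_comp_eq (volume : Measure (κ → ℂ)) volume L
    (f := fun z => ENNReal.ofReal (Real.exp (-∑ l, ‖z l‖ ^ 2) / Real.pi ^ Fintype.card κ))
    (by fun_prop) 1 fun z => by rw [one_mul, hL, sum_norm_sq_vecMul_unitary hU]
  conv_rhs => rw [← h, lintegral_map hf L.continuous.measurable]
  rfl

/-- One step of the Bartlett decomposition: adding an independent row to `n` given rows of length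
`m` multiplies the Gram determinant by a gamma variable of shape `m - n`. If the given rows are
dependent, both sides vanish because `0 ^ (-s) = 0` by convention. -/
theorem lintegral_gramDet_cons_rpow_neg {n m : ℕ} (V : Fin n → Fin m → ℂ) {s : ℝ} (hs : 0 < s)
    (hsm : s < (m : ℝ) - n) :
    ∫⁻ z, ENNReal.ofReal (gramDet (Fin.cons z V : Fin (n + 1) → Fin m → ℂ) ^ (-s))
        ∂stdComplexVector (Fin m) =
      ENNReal.ofReal (Real.Gamma ((m : ℝ) - n - s) / Real.Gamma ((m : ℝ) - n)) *
        ENNReal.ofReal (gramDet V ^ (-s)) := by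
  by_cases hV : gramDet V = 0
  · simp [gramDet_cons_eq_zero hV, hV, Real.zero_rpow (neg_ne_zero.mpr hs.ne')]
  · obtain ⟨U, S, hU, hU', hS, hz⟩ := exists_gramDet_cons_eq V hV
    have hS' : (m : ℝ) - n = S.card := by
      have : (n : ℝ) + S.card = m := by exact_mod_cast hS
      linarith
    rw [hS'] at hsm ⊢
    rw [← lintegral_sum_norm_sq_rpow_neg_stdComplexVector S hs hsm,
      ← lintegral_comp_vecMul_unitary hU hU'
        (f := fun z => ENNReal.ofReal ((∑ l ∈ S, ‖z l‖ ^ 2) ^ (-s))) (by fun_prop),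
      ← lintegral_mul_const' _ _ ENNReal.ofReal_ne_top]
    refine lintegral_congr fun z => ?_
    rw [hz z, Real.mul_rpow (gramDet_nonneg V) (by positivity), mul_comm,
      ENNReal.ofReal_mul (by positivity)]

theorem lintegral_stdComplexMatrix_succ {n : ℕ} {κ : Type*} [Fintype κ]
    {f : (Fin (n + 1) → κ → ℂ) → ENNReal} (hf : Measurable f) :
    ∫⁻ Z, f Z ∂stdComplexMatrix (Fin (n + 1)) κ =
      ∫⁻ V, (∫⁻ z, f (Fin.cons z V) ∂stdComplexVector κ) ∂stdComplexMatrix (Fin n) κ := by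
  have h := measurePreserving_piFinSuccAbove (fun _ : Fin (n + 1) => stdComplexVector κ) 0
  unfold stdComplexMatrix
  rw [← (h.symm).lintegral_comp hf, lintegral_prod_symm]
  · refine lintegral_congr fun V => lintegral_congr fun z => ?_
    congr 1
    exact (MeasurableEquiv.symm_apply_eq _).mpr rfl
  · exact (hf.comp (MeasurableEquiv.measurable _)).aemeasurable

/-- The factors `Γ(m - i - s) / Γ(m - i)`, `i < n`, contributed by the successive rows appear in
reversed order, `j = n - 1 - i`. -/
theorem lintegral_gramDet_rpow_neg (n m : ℕ) {s : ℝ} (hs : 0 < s) (hsm : s < (m : ℝ) - n + 1) :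
    ∫⁻ Z, ENNReal.ofReal (gramDet Z ^ (-s)) ∂stdComplexMatrix (Fin n) (Fin m) =
      ENNReal.ofReal (∏ j ∈ Finset.range n,
        Real.Gamma ((m : ℝ) - n + 1 - s + j) / Real.Gamma ((m : ℝ) - n + 1 + j)) := by
  induction n with
  | zero => simp [gramDet]
  | succ n ih =>
    push_cast at hsm ih ⊢
    have hmn : s < (m : ℝ) - n := by linarith
    rw [lintegral_stdComplexMatrix_succ (measurable_gramDet.pow_const _).ennreal_ofReal]
    simp only [lintegral_gramDet_cons_rpow_neg _ hs hmn]
    rw [lintegral_const_mul' _ _ ENNReal.ofReal_ne_top, ih (by linarith), ← ENNReal.ofReal_mul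
      (div_nonneg (Real.Gamma_pos_of_pos (by linarith)).le
        (Real.Gamma_pos_of_pos (by linarith)).le), Finset.prod_range_succ', mul_comm]
    congr 2
    · refine Finset.prod_congr rfl fun j _ => ?_
      congr 2 <;> push_cast <;> ring
    · congr 2 <;> push_cast <;> ring

/-! ### Reduction of a Gaussian matrix to the standard one -/

theorem re_quadratic_form_inv_mulVec {n : ℕ} {A : Matrix (Fin n) (Fin n) ℂ} (hA : A.det ≠ 0)
    (z : Fin n → ℂ) :
    (star (A *ᵥ z) ⬝ᵥ ((A * Aᴴ)⁻¹ *ᵥ (A *ᵥ z))).re = ∑ i, ‖z i‖ ^ 2 := by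
  have hu : IsUnit A.det := isUnit_iff_ne_zero.mpr hA
  have hu' : IsUnit Aᴴ.det := by rw [det_conjTranspose]; exact hu.star
  rw [Matrix.mul_inv_rev, mulVec_mulVec, Matrix.mul_assoc, nonsing_inv_mul _ hu, Matrix.mul_one,
    star_mulVec, ← dotProduct_mulVec, mulVec_mulVec, mul_nonsing_inv _ hu', one_mulVec,
    ← sum_norm_sq_eq_dotProduct, Complex.ofReal_re]

theorem measurable_complexGaussian_density {n : ℕ} (R : Matrix (Fin n) (Fin n) ℂ) :
    Measurable fun x : Fin n → ℂ =>
      ENNReal.ofReal (Real.exp (-(star x ⬝ᵥ (R⁻¹ *ᵥ x)).re) / (Real.pi ^ n * R.det.re)) := by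
  have h : Continuous fun x : Fin n → ℂ => (star x ⬝ᵥ (R⁻¹ *ᵥ x)).re :=
    Complex.continuous_re.comp
      (continuous_star.dotProduct (Continuous.matrix_mulVec continuous_const continuous_id))
  exact (h.measurable.neg.exp.div_const _).ennreal_ofReal

namespace IsComplexGaussianMatrix

variable {Ω : Type*} [MeasurableSpace Ω] {n m : ℕ} {X : Ω → Matrix (Fin n) (Fin m) ℂ}
  {R : Matrix (Fin n) (Fin n) ℂ} {P : Measure Ω}

theorem aemeasurable (hX : IsComplexGaussianMatrix X R P) :
    AEMeasurable (fun ω => Matrix.of.symm (X ω)) P :=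
  aemeasurable_pi_lambda _ fun i => aemeasurable_pi_lambda _ fun l =>
    (measurable_pi_apply i).comp_aemeasurable (hX.hasLaw_col l).aemeasurable

/-- A complex Gaussian matrix with covariance `A A†` has the law of `A Z` for a standard complex
Gaussian matrix `Z`. The left side is described by columns and the right side by rows, so the
linear isomorphism transporting the laws also transposes. -/
theorem lintegral_eq [IsProbabilityMeasure P] {A : Matrix (Fin n) (Fin n) ℂ}
    (hX : IsComplexGaussianMatrix X (A * Aᴴ) P) (hm : 0 < m) (hA : A.det ≠ 0)
    {f : (Fin n → Fin m → ℂ) → ENNReal} (hf : Measurable f) :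
    ∫⁻ ω, f (Matrix.of.symm (X ω)) ∂P =
      ∫⁻ Z, f (Matrix.of.symm (A * Matrix.of Z)) ∂stdComplexMatrix (Fin n) (Fin m) := by
  have hu : IsUnit A.det := isUnit_iff_ne_zero.mpr hA
  -- The normalization of the Gaussian density needs no computation: it is the law of a column.
  have hprob : IsProbabilityMeasure (complexGaussian (A * Aᴴ)) := by
    rw [← (hX.hasLaw_col ⟨0, hm⟩).map_eq]
    exact Measure.isProbabilityMeasure_map (hX.hasLaw_col ⟨0, hm⟩).aemeasurable
  have hlaw : P.map (fun ω l => (X ω).col l) =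
      Measure.pi fun _ : Fin m => complexGaussian (A * Aᴴ) := by
    rw [(iIndepFun_iff_map_fun_eq_pi_map fun l => (hX.hasLaw_col l).aemeasurable).mp
      hX.iIndepFun_col]
    congr 1
    funext l
    exact (hX.hasLaw_col l).map_eq
  set C : ℝ := Real.pi ^ n * (A * Aᴴ).det.re with hC
  have hCpos : 0 < C := by
    have h : (A * Aᴴ).det = ((‖A.det‖ ^ 2 : ℝ) : ℂ) := by
      rw [det_mul, det_conjTranspose, Complex.ofReal_pow, ← Complex.mul_conj']
      rfl
    rw [hC, h, Complex.ofReal_re]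
    have := norm_pos_iff.mpr hA
    positivity
  have hpi : (Measure.pi fun _ : Fin m => complexGaussian (A * Aᴴ)) =
      (volume : Measure (Fin m → Fin n → ℂ)).withDensity fun x => ∏ l, ENNReal.ofReal
        (Real.exp (-(star (x l) ⬝ᵥ ((A * Aᴴ)⁻¹ *ᵥ x l)).re) / C) := by
    unfold complexGaussian at hprob ⊢
    exact pi_withDensity (fun _ : Fin m => (volume : Measure (Fin n → ℂ)))
      fun _ => measurable_complexGaussian_density (A * Aᴴ)
  let L : (Fin n → Fin m → ℂ) ≃L[ℝ] (Fin m → Fin n → ℂ) := LinearEquiv.toContinuousLinearEquiv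
    { toFun := fun Z l => A *ᵥ fun i => Z i l
      map_add' := fun Z W => by
        funext l
        exact mulVec_add A (fun i => Z i l) (fun i => W i l)
      map_smul' := fun t Z => by
        funext l
        exact mulVec_smul A t (fun i => Z i l)
      invFun := fun x i l => (A⁻¹ *ᵥ x l) i
      left_inv := fun Z => by
        funext i l
        simp [mulVec_mulVec, nonsing_inv_mul _ hu]
      right_inv := fun x => by
        funext l
        change A *ᵥ (A⁻¹ *ᵥ x l) = x l
        rw [mulVec_mulVec, mul_nonsing_inv _ hu, one_mulVec] }
  have hL : ∀ Z l, L Z l = A *ᵥ fun i => Z i l := fun _ _ => rfl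
  have hprob1 := isProbabilityMeasure_stdComplexMatrix (Fin n) (Fin m)
  have hprob2 : IsProbabilityMeasure (Measure.pi fun _ : Fin m => complexGaussian (A * Aᴴ)) :=
    inferInstance
  have := isAddHaarMeasure_volume_pi_pi (Fin n) (Fin m)
  have := isAddHaarMeasure_volume_pi_pi (Fin m) (Fin n)
  rw [stdComplexMatrix_eq_withDensity] at hprob1
  rw [hpi] at hprob2
  have hmap := map_withDensity_of_comp_eq (volume : Measure (Fin n → Fin m → ℂ))
    (volume : Measure (Fin m → Fin n → ℂ)) L
    (f := fun x => ∏ l, ENNReal.ofReal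
      (Real.exp (-(star (x l) ⬝ᵥ ((A * Aᴴ)⁻¹ *ᵥ x l)).re) / C))
    (g := fun Z => ENNReal.ofReal (Real.exp (-∑ i, ∑ l, ‖Z i l‖ ^ 2) /
        (Real.pi ^ Fintype.card (Fin m)) ^ Fintype.card (Fin n)))
    (Finset.measurable_prod _ fun l _ =>
      (measurable_complexGaussian_density (A * Aᴴ)).comp (measurable_pi_apply l))
    (ENNReal.ofReal (C ^ m / (Real.pi ^ m) ^ n)) fun Z => by
      simp only [hL, re_quadratic_form_inv_mulVec hA, Fintype.card_fin]
      rw [prod_ofReal_exp_neg_div _ hCpos.le, ← ENNReal.ofReal_mul (by positivity),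
        Fintype.card_fin, Finset.sum_comm]
      congr 1
      field_simp
  rw [← hpi, ← stdComplexMatrix_eq_withDensity] at hmap
  have hft : Measurable fun x : Fin m → Fin n → ℂ => f fun i l => x l i :=
    hf.comp (by fun_prop)
  calc ∫⁻ ω, f (Matrix.of.symm (X ω)) ∂P
      = ∫⁻ x, f (fun i l => x l i) ∂P.map (fun ω l => (X ω).col l) := by
        rw [lintegral_map' hft.aemeasurable
          (aemeasurable_pi_lambda _ fun l => (hX.hasLaw_col l).aemeasurable)]
        rfl
    _ = _ := by
        rw [hlaw, ← hmap, lintegral_map hft L.continuous.measurable]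
        rfl

end IsComplexGaussianMatrix

/-! ### The test statistic in terms of row norms and the Gram determinant -/

theorem trace_mul_conjTranspose_re {ι κ : Type*} [Fintype ι] [Fintype κ] (Z : Matrix ι κ ℂ)
    (y : ι → ℝ) [DecidableEq ι] :
    (diagonal (fun i => (y i : ℂ)) * (Z * Zᴴ)).trace.re = ∑ i, y i * ∑ l, ‖Z i l‖ ^ 2 := by
  have h : (diagonal (fun i => (y i : ℂ)) * (Z * Zᴴ)).trace =
      ((∑ i, y i * ∑ l, ‖Z i l‖ ^ 2 : ℝ) : ℂ) := by
    rw [trace]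
    push_cast
    refine Finset.sum_congr rfl fun i _ => ?_
    rw [diag_apply, diagonal_mul, Matrix.mul_apply]
    congr 1
    exact Finset.sum_congr rfl fun l _ => Complex.mul_conj' (Z i l)
  rw [h, Complex.ofReal_re]

theorem norm_det_sq_of_conjTranspose_mul {ι : Type*} [Fintype ι] [DecidableEq ι]
    {A : Matrix ι ι ℂ} {y : ι → ℝ} (hA : Aᴴ * A = diagonal fun i => (y i : ℂ)) :
    ‖A.det‖ ^ 2 = ∏ i, y i := by
  have h : ((‖A.det‖ ^ 2 : ℝ) : ℂ) = ((∏ i, y i : ℝ) : ℂ) := by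
    rw [Complex.ofReal_prod, ← det_diagonal, ← hA, det_mul, det_conjTranspose,
      Complex.ofReal_pow, ← Complex.conj_mul']
    rfl
  exact_mod_cast h

section Statistic

variable {n m : ℕ}

theorem glrtStatistic_nonneg (X : Matrix (Fin n) (Fin m) ℂ) : 0 ≤ glrtStatistic X := by
  refine div_nonneg (div_nonneg ?_ n.cast_nonneg)
    (Real.rpow_nonneg (gramDet_nonneg (Matrix.of.symm X)) _)
  exact (Complex.le_def.mp (posSemidef_self_mul_conjTranspose X).trace_nonneg).1

theorem measurable_glrtStatistic :
    Measurable fun Z : Fin n → Fin m → ℂ => glrtStatistic (Matrix.of Z) := by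
  have h : Continuous fun Z : Fin n → Fin m → ℂ => Matrix.of Z :=
    continuous_matrix fun i j => (continuous_apply j).comp (continuous_apply i)
  have ht : Measurable fun Z : Fin n → Fin m → ℂ => (Matrix.of Z * (Matrix.of Z)ᴴ).trace.re :=
    (Complex.continuous_re.comp (h.matrix_mul h.matrix_conjTranspose).matrix_trace).measurable
  exact (ht.div_const _).div (measurable_gramDet.pow_const _)

/-- If `A† A = diag y`, the statistic of `A Z` depends on `Z` only through its row norms, weighted
by `y`, and its Gram determinant. -/
theorem glrtStatistic_mul_pow {A : Matrix (Fin n) (Fin n) ℂ} {y : Fin n → ℝ}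
    (hA : Aᴴ * A = diagonal fun i => (y i : ℂ)) (Z : Fin n → Fin m → ℂ) (p : ℕ) :
    glrtStatistic (A * Matrix.of Z) ^ p =
      (∏ i, y i) ^ (-((p : ℝ) / n)) / (n : ℝ) ^ p *
        ((∑ i, y i * ∑ l, ‖Z i l‖ ^ 2) ^ p * gramDet Z ^ (-((p : ℝ) / n))) := by
  have htr : ((A * Matrix.of Z) * (A * Matrix.of Z)ᴴ).trace.re =
      ∑ i, y i * ∑ l, ‖Z i l‖ ^ 2 := by
    rw [conjTranspose_mul, ← Matrix.mul_assoc, trace_mul_comm, Matrix.mul_assoc A,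
      ← Matrix.mul_assoc Aᴴ, hA, trace_mul_conjTranspose_re]
    rfl
  have hdet : ((A * Matrix.of Z) * (A * Matrix.of Z)ᴴ).det.re = (∏ i, y i) * gramDet Z := by
    rw [← norm_det_sq_of_conjTranspose_mul hA, ← gramDet_of_mul]
    rfl
  have hy : 0 ≤ ∏ i, y i := by
    rw [← norm_det_sq_of_conjTranspose_mul hA]
    positivity
  have hg := gramDet_nonneg Z
  rw [glrtStatistic, htr, hdet, div_pow, div_pow, ← Real.rpow_natCast (_ ^ (1 / (n : ℝ))),
    ← Real.rpow_mul (mul_nonneg hy hg), one_div_mul_eq_div, Real.mul_rpow hy hg,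
    Real.rpow_neg hy, Real.rpow_neg hg]
  ring

end Statistic

/-! ### Eigenvalues of the signal covariance -/

theorem exists_equiv_of_multiset_map_eq {ι α : Type*} [Fintype ι] {f g : ι → α}
    (h : Finset.univ.val.map f = Finset.univ.val.map g) : ∃ σ : ι ≃ ι, ∀ i, g (σ i) = f i := by
  classical
  have hc : ∀ a, Nonempty ({i // f i = a} ≃ {i // g i = a}) := by
    intro a
    have := congrArg (Multiset.count a) h
    rw [Multiset.count_map, Multiset.count_map] at this
    refine ⟨Fintype.equivOfCardEq ?_⟩
    rw [Fintype.card_subtype, Fintype.card_subtype]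
    simp only [eq_comm (a := a)] at this
    exact this
  exact ⟨Equiv.ofFiberEquiv fun a => (hc a).some, fun i => Equiv.ofFiberEquiv_map _ i⟩

/-- The characteristic polynomial determines the diagonal form up to the order of the entries, and
a reordering is absorbed into the unitary matrix. -/
theorem exists_unitary_of_charpoly_eq {ι : Type*} [Fintype ι] [DecidableEq ι]
    {U : Matrix ι ι ℂ} (hU : Uᴴ * U = 1) {w y : ι → ℝ}
    (hy : (U * diagonal (fun i => (w i : ℂ)) * Uᴴ).charpoly =
      ∏ i, (Polynomial.X - Polynomial.C (y i : ℂ))) :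
    ∃ (σ : ι ≃ ι) (V : Matrix ι ι ℂ), (∀ i, y i = w (σ i)) ∧ Vᴴ * V = 1 ∧
      U * diagonal (fun i => (w i : ℂ)) * Uᴴ = V * diagonal (fun i => (y i : ℂ)) * Vᴴ := by
  rw [charpoly_mul_comm, ← Matrix.mul_assoc, hU, Matrix.one_mul, charpoly_diagonal] at hy
  have hr : ∀ v : ι → ℝ, (∏ i, (Polynomial.X - Polynomial.C (v i : ℂ))).roots =
      Finset.univ.val.map fun i => (v i : ℂ) := by
    intro v
    rw [← Polynomial.roots_multiset_prod_X_sub_C (Finset.univ.val.map fun i => (v i : ℂ)),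
      Multiset.map_map]
    rfl
  have hm := congrArg Polynomial.roots hy
  rw [hr, hr] at hm
  obtain ⟨σ, hσ⟩ := exists_equiv_of_multiset_map_eq hm.symm
  have hσ' : ∀ i, y i = w (σ i) := fun i => by exact_mod_cast (hσ i).symm
  refine ⟨σ, U.submatrix id σ, hσ', ?_, ?_⟩
  · rw [conjTranspose_submatrix, submatrix_mul _ _ σ id σ Function.bijective_id |>.symm, hU,
      submatrix_one_equiv]
  · have hd : diagonal (fun i => (y i : ℂ)) =
        (diagonal fun i => (w i : ℂ)).submatrix σ σ := by
      rw [submatrix_diagonal_equiv]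
      congr 1
      funext i
      rw [hσ' i]
      rfl
    rw [hd, conjTranspose_submatrix, submatrix_mul_equiv, submatrix_mul_equiv, submatrix_id_id]

theorem exists_unitary_signalCovariance {n k : ℕ} {H : Matrix (Fin n) (Fin k) ℂ}
    (hH : (H * Hᴴ).PosDef) {N₀ : ℝ} {y : Fin n → ℝ}
    (hy : (signalCovariance H N₀).charpoly =
      ∏ i, (Polynomial.X - Polynomial.C ((y i : ℝ) : ℂ))) :
    (∀ i, N₀ < y i) ∧ ∃ V : Matrix (Fin n) (Fin n) ℂ, Vᴴ * V = 1 ∧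
      signalCovariance H N₀ = V * diagonal (fun i => (y i : ℂ)) * Vᴴ := by
  obtain ⟨U, hU, hU', hD⟩ := exists_unitary_diagonalization hH.isHermitian
  have hS : signalCovariance H N₀ =
      U * diagonal (fun i => ((hH.isHermitian.eigenvalues i + N₀ : ℝ) : ℂ)) * Uᴴ := by
    have hd : diagonal (fun i => ((hH.isHermitian.eigenvalues i + N₀ : ℝ) : ℂ)) =
        diagonal (fun i => (hH.isHermitian.eigenvalues i : ℂ)) +
          (N₀ : ℂ) • (1 : Matrix (Fin n) (Fin n) ℂ) := by
      rw [smul_one_eq_diagonal, diagonal_add]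
      simp
    rw [hd, Matrix.mul_add, Matrix.add_mul, ← hD, Matrix.mul_smul, Matrix.mul_one,
      Matrix.smul_mul, hU]
    rfl
  rw [hS] at hy ⊢
  obtain ⟨σ, V, hσ, hV, hUV⟩ := exists_unitary_of_charpoly_eq hU' hy
  refine ⟨fun i => ?_, V, hV, hUV⟩
  rw [hσ i]
  have := hH.eigenvalues_pos (σ i)
  linarith

/-! ### Moments of the statistic -/

section Moments

variable {Ω : Type*} [MeasurableSpace Ω] {n m : ℕ} {X : Ω → Matrix (Fin n) (Fin m) ℂ}
  {P : Measure Ω}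

theorem lintegral_glrtStatistic_pow [IsProbabilityMeasure P] {A : Matrix (Fin n) (Fin n) ℂ}
    {y : Fin n → ℝ}
    (hA : Aᴴ * A = diagonal fun i => (y i : ℂ)) (hy : ∀ i, 0 < y i)
    (hX : IsComplexGaussianMatrix X (A * Aᴴ) P) (hm : 0 < m) (p : ℕ) :
    ∫⁻ ω, ENNReal.ofReal (glrtStatistic (X ω) ^ p) ∂P =
      ENNReal.ofReal ((∏ i, y i) ^ (-((p : ℝ) / n)) / (n : ℝ) ^ p) *
        ∫⁻ Z, ENNReal.ofReal ((∑ i, y i * ∑ l, ‖Z i l‖ ^ 2) ^ p) *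
          ENNReal.ofReal (gramDet Z ^ (-((p : ℝ) / n))) ∂stdComplexMatrix (Fin n) (Fin m) := by
  have hprod : 0 < ∏ i, y i := Finset.prod_pos fun i _ => hy i
  have hdet : A.det ≠ 0 := by
    have h := norm_det_sq_of_conjTranspose_mul hA
    intro h0
    rw [h0, norm_zero, zero_pow two_ne_zero] at h
    exact hprod.ne h
  have h := hX.lintegral_eq hm hdet
    (f := fun Z => ENNReal.ofReal (glrtStatistic (Matrix.of Z) ^ p))
    (measurable_glrtStatistic.pow_const p).ennreal_ofReal
  simp only [Equiv.apply_symm_apply] at h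
  rw [h, ← lintegral_const_mul' _ _ ENNReal.ofReal_ne_top]
  refine lintegral_congr fun Z => ?_
  have hq : 0 ≤ ∑ i, y i * ∑ l, ‖Z i l‖ ^ 2 :=
    Finset.sum_nonneg fun i _ => mul_nonneg (hy i).le (by positivity)
  rw [glrtStatistic_mul_pow hA, ENNReal.ofReal_mul (by positivity),
    ENNReal.ofReal_mul (by positivity)]

theorem integrable_and_integral_glrtStatistic_pow {R : Matrix (Fin n) (Fin n) ℂ}
    (hX : IsComplexGaussianMatrix X R P) {p : ℕ} {v : ℝ} (hv : 0 ≤ v)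
    (h : ∫⁻ ω, ENNReal.ofReal (glrtStatistic (X ω) ^ p) ∂P = ENNReal.ofReal v) :
    Integrable (fun ω => glrtStatistic (X ω) ^ p) P ∧ ∫ ω, glrtStatistic (X ω) ^ p ∂P = v := by
  have hm : AEStronglyMeasurable (fun ω => glrtStatistic (X ω) ^ p) P :=
    ((measurable_glrtStatistic.comp_aemeasurable hX.aemeasurable).pow_const p).aestronglyMeasurable
  have h0 : 0 ≤ᵐ[P] fun ω => glrtStatistic (X ω) ^ p :=
    ae_of_all _ fun ω => pow_nonneg (glrtStatistic_nonneg _) _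
  refine ⟨⟨hm, ?_⟩, ?_⟩
  · rw [hasFiniteIntegral_iff_ofReal h0, h]
    exact ENNReal.ofReal_lt_top
  · rw [integral_eq_lintegral_of_nonneg_ae h0 hm, h, ENNReal.toReal_ofReal hv]

end Moments

theorem gramDet_rpow_smul {n m : ℕ} (hn : 0 < n) (p : ℕ) {t : ℝ} (ht : 0 < t)
    (Z : Fin n → Fin m → ℂ) :
    ENNReal.ofReal (gramDet (t • Z) ^ (-((p : ℝ) / n))) =
      ENNReal.ofReal (t ^ (2 * (-(p : ℝ)))) * ENNReal.ofReal (gramDet Z ^ (-((p : ℝ) / n))) := by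
  have hn' : (n : ℝ) ≠ 0 := by positivity
  rw [← ENNReal.ofReal_mul (by positivity), gramDet_smul,
    Real.mul_rpow (by positivity) (gramDet_nonneg Z), ← pow_mul, ← Real.rpow_natCast,
    ← Real.rpow_mul ht.le, Fintype.card_fin]
  congr 3
  push_cast
  field_simp

theorem gramDet_update_rpow_smul {n m : ℕ} (s : ℝ) {t : ℝ} (ht : 0 < t)
    (Z : Fin n → Fin m → ℂ) (i : Fin n) (z : Fin m → ℂ) :
    ENNReal.ofReal (gramDet (Function.update Z i (t • z)) ^ (-s)) =
      ENNReal.ofReal (t ^ (2 * (-s))) *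
        ENNReal.ofReal (gramDet (Function.update Z i z) ^ (-s)) := by
  rw [← ENNReal.ofReal_mul (by positivity), gramDet_update_smul,
    Real.mul_rpow (by positivity) (gramDet_nonneg _), Real.rpow_mul ht.le, Real.rpow_two]

/-- The weighted moment for equal eigenvalues: the squared Frobenius norm is a gamma variable
under the weight `det(Z Z†)^(-p/n)`, which is homogeneous of total degree `-2p`. -/
theorem lintegral_total_norm_sq_pow_mul_gramDet {n m p : ℕ} (hn : 0 < n) (hm : 0 < m)
    (hp : 0 < p) (hpm : (p : ℝ) < m * n) (hs : (p : ℝ) / n < (m : ℝ) - n + 1) :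
    ∫⁻ Z, ENNReal.ofReal ((∑ i, ∑ l, ‖Z i l‖ ^ 2) ^ p) *
        ENNReal.ofReal (gramDet Z ^ (-((p : ℝ) / n))) ∂stdComplexMatrix (Fin n) (Fin m) =
      ENNReal.ofReal (Real.Gamma ((m : ℝ) * n) / Real.Gamma ((m : ℝ) * n - p) *
        ∏ j ∈ Finset.range n,
          Real.Gamma ((m : ℝ) - n + 1 - (p : ℝ) / n + j) / Real.Gamma ((m : ℝ) - n + 1 + j)) := by
  have : Nonempty (Fin n) := ⟨⟨0, hn⟩⟩
  have : Nonempty (Fin m) := ⟨⟨0, hm⟩⟩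
  have hα : 0 < (m : ℝ) * n - p := sub_pos.mpr hpm
  rw [lintegral_norm_sq_pow_mul_stdComplexMatrix
    (measurable_gramDet.pow_const _).ennreal_ofReal (β := -(p : ℝ)) (α := (m : ℝ) * n - p)
    (fun t ht Z => gramDet_rpow_smul hn p ht Z)
    (by rw [Fintype.card_fin, Fintype.card_fin]; ring) hα,
    lintegral_gramDet_rpow_neg n m (by positivity) hs, sub_add_cancel, ENNReal.ofReal_mul]
  exact div_nonneg (Real.Gamma_nonneg_of_nonneg (by positivity))
    (Real.Gamma_nonneg_of_nonneg hα.le)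

/-- The weighted moment for arbitrary eigenvalues, by the multinomial theorem: under the weight
`det(Z Z†)^(-p/n)` the squared row norms are independent gamma variables of shape `m - p/n`. -/
theorem lintegral_weighted_norm_sq_pow_mul_gramDet {n m p : ℕ} (hm : 0 < m)
    (hs0 : 0 < (p : ℝ) / n) (hs : (p : ℝ) / n < (m : ℝ) - n + 1) (hsm : (p : ℝ) / n < m)
    {y : Fin n → ℝ} (hy : ∀ i, 0 < y i) :
    ∫⁻ Z, ENNReal.ofReal ((∑ i, y i * ∑ l, ‖Z i l‖ ^ 2) ^ p) *
        ENNReal.ofReal (gramDet Z ^ (-((p : ℝ) / n))) ∂stdComplexMatrix (Fin n) (Fin m) =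
      ENNReal.ofReal ((∑ κ ∈ Finset.piAntidiag (Finset.univ : Finset (Fin n)) p,
          (p.factorial : ℝ) * ∏ i, Real.Gamma ((m : ℝ) - (p : ℝ) / n + κ i) * y i ^ κ i /
            (Real.Gamma ((κ i : ℝ) + 1) * Real.Gamma ((m : ℝ) - (p : ℝ) / n))) *
        ∏ j ∈ Finset.range n,
          Real.Gamma ((m : ℝ) - n + 1 - (p : ℝ) / n + j) / Real.Gamma ((m : ℝ) - n + 1 + j)) := by
  have : Nonempty (Fin m) := ⟨⟨0, hm⟩⟩
  set s := (p : ℝ) / n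
  have hα : 0 < (m : ℝ) - s := sub_pos.mpr hsm
  have hΓ : ∀ j : ℕ, 0 < Real.Gamma ((m : ℝ) - s + j) := fun j =>
    Real.Gamma_pos_of_pos (by positivity)
  have hΓ0 : 0 < Real.Gamma ((m : ℝ) - s) := Real.Gamma_pos_of_pos hα
  have hΓ1 : ∀ j : ℕ, 0 < Real.Gamma ((j : ℝ) + 1) := fun j =>
    Real.Gamma_pos_of_pos (by positivity)
  have hg : Measurable fun Z : Fin n → Fin m → ℂ => ENNReal.ofReal (gramDet Z ^ (-s)) :=
    (measurable_gramDet.pow_const _).ennreal_ofReal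
  have hterm : ∀ κ ∈ Finset.piAntidiag (Finset.univ : Finset (Fin n)) p,
      (Nat.multinomial Finset.univ κ : ℝ) * (∏ i, y i ^ κ i) *
        (∏ i, Real.Gamma ((m : ℝ) - s + κ i) / Real.Gamma ((m : ℝ) - s)) =
      (p.factorial : ℝ) * ∏ i, Real.Gamma ((m : ℝ) - s + κ i) * y i ^ κ i /
        (Real.Gamma ((κ i : ℝ) + 1) * Real.Gamma ((m : ℝ) - s)) := by
    intro κ hκ
    have hsum : ∑ i, κ i = p := (Finset.mem_piAntidiag.mp hκ).1
    have hmul : (∏ i, ((κ i).factorial : ℝ)) * (Nat.multinomial Finset.univ κ : ℝ) =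
        (p.factorial : ℝ) := by
      rw [← hsum]
      exact_mod_cast Nat.multinomial_spec Finset.univ κ
    have hf : ∏ i, ((κ i).factorial : ℝ) ≠ 0 :=
      Finset.prod_ne_zero_iff.mpr fun i _ => by positivity
    rw [← hmul, mul_assoc, ← Finset.prod_mul_distrib, mul_comm (∏ i, ((κ i).factorial : ℝ)),
      mul_assoc, ← Finset.prod_mul_distrib]
    congr 1
    refine Finset.prod_congr rfl fun i _ => ?_
    rw [Real.Gamma_nat_eq_factorial]
    have : ((κ i).factorial : ℝ) ≠ 0 := by positivity
    field_simp
  have hexp : ∀ Z : Fin n → Fin m → ℂ,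
      ENNReal.ofReal ((∑ i, y i * ∑ l, ‖Z i l‖ ^ 2) ^ p) * ENNReal.ofReal (gramDet Z ^ (-s)) =
      ∑ κ ∈ Finset.piAntidiag (Finset.univ : Finset (Fin n)) p,
        ENNReal.ofReal ((Nat.multinomial Finset.univ κ : ℝ) * ∏ i, y i ^ κ i) *
          (ENNReal.ofReal (∏ i, (∑ l, ‖Z i l‖ ^ 2) ^ κ i) *
            ENNReal.ofReal (gramDet Z ^ (-s))) := by
    intro Z
    have hyp : ∀ κ : Fin n → ℕ, 0 ≤ ∏ i, y i ^ κ i := fun κ =>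
      Finset.prod_nonneg fun i _ => pow_nonneg (hy i).le _
    rw [Finset.sum_pow_eq_sum_piAntidiag, ENNReal.ofReal_sum_of_nonneg, Finset.sum_mul]
    · refine Finset.sum_congr rfl fun κ _ => ?_
      have := hyp κ
      simp only [mul_pow, Finset.prod_mul_distrib]
      rw [← mul_assoc (Nat.multinomial Finset.univ κ : ℝ), ENNReal.ofReal_mul (by positivity),
        mul_assoc]
    · intro κ _
      have := hyp κ
      simp only [mul_pow, Finset.prod_mul_distrib]
      positivity
  simp only [hexp]
  rw [lintegral_finsetSum _ fun κ _ => by fun_prop, ENNReal.ofReal_mul,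
    ENNReal.ofReal_sum_of_nonneg, Finset.sum_mul, ← lintegral_gramDet_rpow_neg n m hs0 hs]
  · refine Finset.sum_congr rfl fun κ hκ => ?_
    have hyp : 0 ≤ ∏ i, y i ^ κ i := Finset.prod_nonneg fun i _ => pow_nonneg (hy i).le _
    rw [lintegral_const_mul' _ _ ENNReal.ofReal_ne_top,
      lintegral_prod_row_norm_sq_pow_mul_stdComplexMatrix hg (β := -s) (α := (m : ℝ) - s)
        (fun t ht Z i z => gramDet_update_rpow_smul s ht Z i z)
        (by rw [Fintype.card_fin]; ring) hα,
      ← mul_assoc, ← ENNReal.ofReal_mul (by positivity), hterm κ hκ]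
  · intro κ _
    exact mul_nonneg (by positivity) (Finset.prod_nonneg fun i _ => div_nonneg
      (mul_nonneg (hΓ _).le (pow_nonneg (hy i).le _)) (mul_pos (hΓ1 _) hΓ0).le)
  · exact Finset.sum_nonneg fun κ _ => mul_nonneg (by positivity)
      (Finset.prod_nonneg fun i _ => div_nonneg
        (mul_nonneg (hΓ _).le (pow_nonneg (hy i).le _)) (mul_pos (hΓ1 _) hΓ0).le)

theorem theorem1 {n m p : ℕ} (hp : 0 < p) (hpn : (p : ℤ) < (n : ℤ) * ((m : ℤ) - n + 1))
    {N₀ : ℝ} (hN₀ : 0 < N₀)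
    {Ω : Type*} [MeasurableSpace Ω] (P : Measure Ω) [IsProbabilityMeasure P]
    (X : Ω → Matrix (Fin n) (Fin m) ℂ) :
    (IsComplexGaussianMatrix X ((N₀ : ℂ) • (1 : Matrix (Fin n) (Fin n) ℂ)) P →
      Integrable (fun ω => glrtStatistic (X ω) ^ p) P ∧
      ∫ ω, glrtStatistic (X ω) ^ p ∂P =
        Real.Gamma ((m : ℝ) * n) / ((n : ℝ) ^ p * Real.Gamma ((m : ℝ) * n - p)) *
          ∏ j ∈ Finset.range n,
            Real.Gamma ((m : ℝ) - n + 1 - (p : ℝ) / n + j) / Real.Gamma ((m : ℝ) - n + 1 + j)) ∧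
    (∀ (k : ℕ) (H : Matrix (Fin n) (Fin k) ℂ), (H * Hᴴ).PosDef →
      ∀ y : Fin n → ℝ,
        (signalCovariance H N₀).charpoly =
          ∏ i, (Polynomial.X - Polynomial.C ((y i : ℝ) : ℂ)) →
        (∀ i, N₀ < y i) ∧
        (IsComplexGaussianMatrix X (signalCovariance H N₀) P →
          Integrable (fun ω => glrtStatistic (X ω) ^ p) P ∧
          ∫ ω, glrtStatistic (X ω) ^ p ∂P =
            (p.factorial : ℝ) * (∏ i, y i ^ (-((p : ℝ) / n))) / (n : ℝ) ^ p *
              (∏ j ∈ Finset.range n,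
                Real.Gamma ((m : ℝ) - n + 1 - (p : ℝ) / n + j) /
                  Real.Gamma ((m : ℝ) - n + 1 + j)) *
              ∑ κ ∈ Finset.piAntidiag (Finset.univ : Finset (Fin n)) p,
                ∏ i, Real.Gamma ((m : ℝ) - (p : ℝ) / n + κ i) * y i ^ κ i /
                  (Real.Gamma ((κ i : ℝ) + 1) * Real.Gamma ((m : ℝ) - (p : ℝ) / n)))) := by
  have hp' : (0 : ℝ) < p := by exact_mod_cast hp
  have hpn' : (p : ℝ) < n * ((m : ℝ) - n + 1) := by exact_mod_cast hpn
  have hn : 0 < n := by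
    rcases Nat.eq_zero_or_pos n with rfl | h
    · simp only [Nat.cast_zero, zero_mul] at hpn'
      exact absurd hpn' hp'.not_gt
    · exact h
  have hn' : (0 : ℝ) < n := by exact_mod_cast hn
  have hn1 : (1 : ℝ) ≤ n := by exact_mod_cast hn
  have hs0 : 0 < (p : ℝ) / n := div_pos hp' hn'
  have hs : (p : ℝ) / n < (m : ℝ) - n + 1 := by
    rw [div_lt_iff₀ hn']
    linarith
  have hsm : (p : ℝ) / n < m := by linarith
  have hm' : (0 : ℝ) < m := hs0.trans hsm
  have hm : 0 < m := by exact_mod_cast hm'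
  have hpm : (p : ℝ) < m * n := (div_lt_iff₀ hn').mp hsm
  have hdet : 0 ≤ ∏ j ∈ Finset.range n,
      Real.Gamma ((m : ℝ) - n + 1 - (p : ℝ) / n + j) / Real.Gamma ((m : ℝ) - n + 1 + j) := by
    refine Finset.prod_nonneg fun j _ => ?_
    have hj : (0 : ℝ) ≤ j := j.cast_nonneg
    exact div_nonneg (Real.Gamma_pos_of_pos (by linarith)).le
      (Real.Gamma_pos_of_pos (by linarith)).le
  refine ⟨fun hX => ?_, fun k H hH y hy => ?_⟩
  · -- All eigenvalues equal `N₀`, which cancels because the statistic is scale invariant.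
    set A : Matrix (Fin n) (Fin n) ℂ := diagonal fun _ => ((√N₀ : ℝ) : ℂ)
    have hsq : ((√N₀ : ℝ) : ℂ) * ((√N₀ : ℝ) : ℂ) = (N₀ : ℂ) := by
      rw [← Complex.ofReal_mul, Real.mul_self_sqrt hN₀.le]
    have hAH : Aᴴ = A := by
      rw [diagonal_conjTranspose]
      congr 1
      funext i
      exact Complex.conj_ofReal _
    have hAA : A * A = diagonal fun _ => (N₀ : ℂ) := by
      rw [diagonal_mul_diagonal]
      simp only [hsq]
    have hR : (N₀ : ℂ) • (1 : Matrix (Fin n) (Fin n) ℂ) = A * Aᴴ := by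
      rw [hAH, hAA, smul_one_eq_diagonal]
    have h := lintegral_glrtStatistic_pow (y := fun _ => N₀) (by rw [hAH, hAA]) (fun _ => hN₀)
      (hR ▸ hX) hm p
    refine integrable_and_integral_glrtStatistic_pow hX (mul_nonneg (div_nonneg
      (Real.Gamma_pos_of_pos (by positivity)).le (mul_nonneg (by positivity)
        (Real.Gamma_pos_of_pos (by linarith)).le)) hdet) ?_
    have hN : (∏ _i : Fin n, N₀) ^ (-((p : ℝ) / n)) * N₀ ^ p = 1 := by
      rw [Finset.prod_const, Finset.card_univ, Fintype.card_fin, ← Real.rpow_natCast N₀ n,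
        ← Real.rpow_mul hN₀.le, ← Real.rpow_natCast N₀ p, ← Real.rpow_add hN₀]
      have : (n : ℝ) * -((p : ℝ) / n) + p = 0 := by field_simp; ring
      rw [this, Real.rpow_zero]
    have hint := lintegral_total_norm_sq_pow_mul_gramDet hn hm hp hpm hs
    simp only [← Finset.mul_sum, mul_pow, ENNReal.ofReal_mul (pow_nonneg hN₀.le p),
      mul_assoc] at h
    rw [h, lintegral_const_mul' _ _ ENNReal.ofReal_ne_top, hint, ← mul_assoc,
      ← ENNReal.ofReal_mul (by positivity), ← ENNReal.ofReal_mul (by positivity),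
      div_mul_eq_mul_div, hN]
    congr 1
    ring
  · -- With `V` unitary diagonalizing the covariance, `V * diag √y` is a square root of it whose
    -- other product `A† A` is `diag y`.
    obtain ⟨hlt, V, hV, hSV⟩ := exists_unitary_signalCovariance hH hy
    refine ⟨hlt, fun hX => ?_⟩
    have hy0 : ∀ i, 0 < y i := fun i => hN₀.trans (hlt i)
    set D : Matrix (Fin n) (Fin n) ℂ := diagonal fun i => ((√(y i) : ℝ) : ℂ)
    have hDH : Dᴴ = D := by
      rw [diagonal_conjTranspose]
      congr 1
      funext i
      exact Complex.conj_ofReal _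
    have hDD : D * D = diagonal fun i => (y i : ℂ) := by
      rw [diagonal_mul_diagonal]
      congr 1
      funext i
      rw [← Complex.ofReal_mul, Real.mul_self_sqrt (hy0 i).le]
    have hR : signalCovariance H N₀ = (V * D) * (V * D)ᴴ := by
      rw [hSV, conjTranspose_mul, hDH, ← hDD]
      simp only [Matrix.mul_assoc]
    have hA : (V * D)ᴴ * (V * D) = diagonal fun i => (y i : ℂ) := by
      rw [conjTranspose_mul, Matrix.mul_assoc, ← Matrix.mul_assoc Vᴴ, hV, Matrix.one_mul, hDH, hDD]
    have hprod : (∏ i, y i) ^ (-((p : ℝ) / n)) = ∏ i, y i ^ (-((p : ℝ) / n)) :=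
      (Real.finsetProd_rpow _ _ (fun i _ => (hy0 i).le) _).symm
    have hprod0 : 0 ≤ ∏ i, y i ^ (-((p : ℝ) / n)) :=
      Finset.prod_nonneg fun i _ => Real.rpow_nonneg (hy0 i).le _
    refine integrable_and_integral_glrtStatistic_pow hX ?_ ?_
    · refine mul_nonneg (mul_nonneg (by positivity) hdet) (Finset.sum_nonneg fun κ _ =>
        Finset.prod_nonneg fun i _ => div_nonneg (mul_nonneg ?_ (pow_nonneg (hy0 i).le _)) ?_)
      · have hκ : (0 : ℝ) ≤ κ i := (κ i).cast_nonneg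
        exact (Real.Gamma_pos_of_pos (by linarith)).le
      · exact mul_nonneg (Real.Gamma_pos_of_pos (by positivity)).le
          (Real.Gamma_pos_of_pos (by linarith)).le
    · rw [lintegral_glrtStatistic_pow hA hy0 (hR ▸ hX) hm p,
        lintegral_weighted_norm_sq_pow_mul_gramDet hm hs0 hs hsm hy0, hprod,
        ← ENNReal.ofReal_mul (by positivity), ← Finset.mul_sum]
      congr 1
      ring
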